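/- Let $\Lambda\subset\mathbb{R}^3$ be a lattice spanned by a basis of $\mathbb{R}^3$, $\Omega$ a unit cell of volume $|\Omega|$, and $\Lambda^\ast=\{K\in\mathbb{R}^3 : K\cdot v\in 2\pi\mathbb{Z}\ \forall v\in\Lambda\}$ the reciprocal lattice. Let $\lambda>0$, $R>0$, $\tau\in\mathbb{R}^3$, $\ell_{\max}\in\mathbb{N}_0$. Let $Y_L$, $L=(\ell,m)$, $|m|\le \ell$, be the standard spherical harmonics (orthonormal on the unit sphere, with Condon–Shortley phase), $j_\nu$ and $i_\nu$ the spherical and modified spherical Bessel functions of the first kind, $\hat x=x/|x|$, and write $\sum_L=\sum_{\ell=0}^{\ell_{\max}}\sum_{m=-\ell}^{\ell}$. For a density $\rho$ on the ball of radius $R$ around $\tau$ define its modified multipole moments $$q_L[\rho]=\frac{(2\ell+1)!!}{\lambda^\ell}\int_{|x|\le R}\rho(x+\tau)\,i_\ell(\lambda|x|)\,\overline{Y_L(\hat x)}\,dx .$$ For each degree $\ell$ choose an order $n=n(\ell)\in\mathbb{N}_0$ (for instance constant in $\ell$) and a leading coefficient $a_n\in\mathbb{C}\setminus\{0\}$ (which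 may depend on $\ell$), and set $\nu=\nu(\ell)=\ell+n+1$. For coefficients $Q_{Ln}\in\mathbb{C}$ let the pseudo-charge density be $$\bar\rho(x+\tau)=\sum_L\rho_L(|x|)\,Y_L(\hat x)\ \ (|x|\le R),\qquad \bar\rho(x+\tau)=0\ \ (|x|>R),$$ $$\rho_L(r)=Q_{Ln}\sum_{\eta=0}^{n}a_\eta r^{\ell+2\eta},\qquad a_\eta=(-1)^{n-\eta}R^{2(n-\eta)}\binom{n}{\eta}a_n .$$ Let $q_L\in\mathbb{C}$ be arbitrary prescribed numbers ($\ell\le\ell_{\max}$, $|m|\le\ell$). (1) One has $q_L[\bar\rho]=q_L$ for all $L$ with $\ell\le\ell_{\max}$ if and only if, for all such $L$, $$Q_{Ln}=q_L\,\frac{\lambda^{\nu}}{a_n(-2)^n\,n!\,R^{\ell+n+2}(2\ell+1)!!\,i_\nu(\lambda R)} .$$ Suppose from now on that this is the case. Then: (2) For $|x|\le R$, $\bar\rho(x+\tau)=\sum_L a_n(|x|^2-R^2)^n\,Q_{Ln}\,|x|^\ell\,Y_L(\hat x)$; in particular, if $n$ and $a_n$ do not depend on $\ell$, $\bar\rho(x+\tau)=a_n(|x|^2-R^2)^n\sum_L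 Q_{Ln}|x|^\ell Y_L(\hat x)$. (3) Let $\bar\rho(K)=\frac1{|\Omega|}\int_\Omega \big(\sum_{v\in\Lambda}\bar\rho(x-v)\big)e^{-iK\cdot x}\,dx$, $K\in\Lambda^\ast$, be the Fourier coefficients of the $\Lambda$-periodic extension of $\bar\rho$. Then $\bar\rho(K)=\frac{1}{|\Omega|}e^{-iK\cdot\tau}\int_{|x|\le R}\bar\rho(x+\tau)e^{-iK\cdot x}\,dx$ for every $K\in\Lambda^\ast$, and for $K\ne0$ $$\bar\rho(K)=\frac{4\pi}{|\Omega|}e^{-iK\cdot\tau}\sum_L(-i)^\ell\,\frac{j_\nu(|K|R)}{|K|^{\nu-\ell}(2\ell+1)!!}\,\frac{\lambda^\nu}{i_\nu(\lambda R)}\,q_L\,Y_L(\hat K).$$ (4) For $K=0$, with $\nu=\nu(0)=n(0)+1$, $$\bar\rho(0)=\frac{\sqrt{4\pi}}{|\Omega|}\,\frac{(\lambda R)^\nu}{(2\nu+1)!!\,i_\nu(\lambda R)}\,q_{00}.$$ (5) For every $L$ with $\ell\le\ell_{\max}$, $\frac{d^k}{dr^k}\rho_L(r)\big|_{r=R}=0$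 for $k=0,\dots,n(\ell)-1$. Moreover, if $0\le k<n(\ell)$ for all $\ell\le\ell_{\max}$, then for every unit vector $u$ the function $r\mapsto\bar\rho(ru+\tau)$ (which is zero for $r>R$) is $k$ times continuously differentiable near $r=R$, and its $k$-th derivative at $R$ is $0$. -/

import Mathlib

open Real MeasureTheory Polynomial
open scoped ComplexConjugate Nat InnerProductSpace

noncomputable section

namespace Yukawa

/-- Three-dimensional Euclidean space. -/
abbrev E3 : Type := EuclideanSpace ℝ (Fin 3)

/-! ### Special functions -/

/-- The spherical Bessel function of the first kind `j_ν`, by its everywhere convergent series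
`x ^ ν / (2 ν + 1)‼ * ∑ s, (-1) ^ s / (s! (ν + 3/2)_s) * (x / 2) ^ (2 s)`,
where `(c)_s = c (c + 1) ⋯ (c + s - 1)`. -/
def sphBesselJ (ν : ℕ) (x : ℝ) : ℝ :=
  x ^ ν / ((2 * ν + 1)‼ : ℝ) *
    ∑' s : ℕ, (-1 : ℝ) ^ s / ((s ! : ℝ) * (ascPochhammer ℝ s).eval ((ν : ℝ) + 3 / 2)) *
      (x / 2) ^ (2 * s)

/-- The modified spherical Bessel function of the first kind `i_ν(x) = i^(-ν) j_ν(i x)`,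
by its everywhere convergent series. -/
def sphBesselI (ν : ℕ) (x : ℝ) : ℝ :=
  x ^ ν / ((2 * ν + 1)‼ : ℝ) *
    ∑' s : ℕ, 1 / ((s ! : ℝ) * (ascPochhammer ℝ s).eval ((ν : ℝ) + 3 / 2)) *
      (x / 2) ^ (2 * s)

/-- The Legendre polynomial `P_ℓ`, by Rodrigues' formula. -/
def legendrePoly (ℓ : ℕ) : ℝ[X] :=
  C (1 / ((2 : ℝ) ^ ℓ * (ℓ ! : ℝ))) * derivative^[ℓ] ((X ^ 2 - 1) ^ ℓ)

/-- The spherical harmonic of degree `ℓ` and order `m ∈ {0, …, ℓ}` at a unit vector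
`u = (sin θ cos φ, sin θ sin φ, cos θ)`. Since `(u 0 + i u 1) ^ m = (sin θ) ^ m e^(i m φ)`,
this is `√((2ℓ+1)/(4π) (ℓ-m)!/(ℓ+m)!) P_ℓ^m(cos θ) e^(i m φ)` with
`P_ℓ^m(t) = (-1)^m (1 - t²)^(m/2) (d/dt)^m P_ℓ(t)`. -/
def sphHarmonicNonneg (ℓ m : ℕ) (u : E3) : ℂ :=
  (((-1 : ℝ) ^ m *
      √((2 * (ℓ : ℝ) + 1) / (4 * π) * (((ℓ - m)! : ℝ) / ((ℓ + m)! : ℝ))) *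
      (derivative^[m] (legendrePoly ℓ)).eval (u 2) : ℝ) : ℂ) *
    ((u 0 : ℂ) + Complex.I * (u 1 : ℂ)) ^ m

/-- The spherical harmonic `Y_{ℓ m}` (`-ℓ ≤ m ≤ ℓ`) on the unit sphere, with
`Y_{ℓ,-m} = (-1)^m conj Y_{ℓ m}`. -/
def sphHarmonic (ℓ : ℕ) (m : ℤ) (u : E3) : ℂ :=
  if 0 ≤ m then sphHarmonicNonneg ℓ m.natAbs u
  else (-1) ^ m.natAbs * conj (sphHarmonicNonneg ℓ m.natAbs u)

/-- The direction `x / |x|` of a vector. -/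
def dir (x : E3) : E3 := ‖x‖⁻¹ • x

/-- The sum over all `L = (ℓ, m)` with `0 ≤ ℓ ≤ ℓmax` and `-ℓ ≤ m ≤ ℓ`. -/
def sumL (ℓmax : ℕ) (f : ℕ → ℤ → ℂ) : ℂ :=
  ∑ ℓ ∈ Finset.range (ℓmax + 1), ∑ m ∈ Finset.Icc (-(ℓ : ℤ)) (ℓ : ℤ), f ℓ m

/-! ### The periodic domain -/

/-- The lattice spanned by the basis `b`. -/
abbrev lattice (b : Module.Basis (Fin 3) ℝ E3) : Submodule ℤ E3 :=
  Submodule.span ℤ (Set.range b)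

/-- The reciprocal lattice: the vectors `K` with `K · v ∈ 2 π ℤ` for all lattice vectors `v`. -/
def reciprocalLattice (b : Module.Basis (Fin 3) ℝ E3) : Set E3 :=
  {K | ∀ v ∈ lattice b, ∃ j : ℤ, ⟪K, v⟫_ℝ = 2 * π * j}

/-- The volume `|Ω|` of the unit cell. -/
def cellVolume (b : Module.Basis (Fin 3) ℝ E3) : ℝ :=
  volume.real (ZSpan.fundamentalDomain b)

/-- The lattice-periodic function obtained by placing a copy of the localized function `f`
at every lattice vector (for `f` of bounded support, a finite sum at each point). -/
def periodize (b : Module.Basis (Fin 3) ℝ E3) (f : E3 → ℂ) (x : E3) : ℂ :=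
  ∑' v : lattice b, f (x - v)

/-- The Fourier coefficient `|Ω|⁻¹ ∫_Ω f(x) e^(-i K · x) dx` of a lattice-periodic function. -/
def fourierCoefficient (b : Module.Basis (Fin 3) ℝ E3) (f : E3 → ℂ) (K : E3) : ℂ :=
  1 / (cellVolume b : ℂ) *
    ∫ x in ZSpan.fundamentalDomain b, f x * Complex.exp (-(Complex.I * (⟪K, x⟫_ℝ : ℂ)))

/-! ### Modified multipole moments and the pseudo-charge density -/

/-- The modified multipole moment `q_{ℓ m}[ρ]` of a charge density `ρ` in the ball of radius `R`
around `τ`: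
`(2ℓ+1)‼ / lam ^ ℓ * ∫_{|x| ≤ R} ρ(x + τ) i_ℓ(lam |x|) conj (Y_{ℓ m}(x/|x|)) dx`. -/
def modMultipole (lam : ℝ) (τ : E3) (R : ℝ) (ρ : E3 → ℂ) (ℓ : ℕ) (m : ℤ) : ℂ :=
  ((2 * ℓ + 1)‼ : ℂ) / (lam : ℂ) ^ ℓ *
    ∫ x in Metric.closedBall (0 : E3) R,
      ρ (x + τ) * (sphBesselI ℓ (lam * ‖x‖) : ℂ) * conj (sphHarmonic ℓ m (dir x))

/-- The coefficients `a_η = (-1)^(n-η) R^(2(n-η)) (n choose η) a_n` (`0 ≤ η ≤ n`) of the radial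
polynomial, where `a` is the leading coefficient `a_n`. -/
def ansatzCoeff (R : ℝ) (n : ℕ) (a : ℂ) (η : ℕ) : ℂ :=
  (-1) ^ (n - η) * (R : ℂ) ^ (2 * (n - η)) * (n.choose η : ℂ) * a

/-- The radial part `ρ_L(r) = Q ∑_{η=0}^n a_η r^(ℓ + 2η)`. -/
def pseudoRadial (R : ℝ) (ℓ n : ℕ) (a Q : ℂ) (r : ℝ) : ℂ :=
  Q * ∑ η ∈ Finset.range (n + 1), ansatzCoeff R n a η * (r : ℂ) ^ (ℓ + 2 * η)

open Classical in
/-- The pseudo-charge density localized in the ball of radius `R` around `τ`: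
`∑_L ρ_L(r) Y_L(x/|x|)` at the point `x + τ` with `r = |x| ≤ R`, and zero outside the ball.
The order `n ℓ` and the leading coefficient `a ℓ` may depend on the degree `ℓ`. -/
def pseudoCharge (τ : E3) (R : ℝ) (ℓmax : ℕ) (n : ℕ → ℕ) (a : ℕ → ℂ) (Q : ℕ → ℤ → ℂ)
    (y : E3) : ℂ :=
  if ‖y - τ‖ ≤ R then
    sumL ℓmax fun ℓ m =>
      pseudoRadial R ℓ (n ℓ) (a ℓ) (Q ℓ m) ‖y - τ‖ * sphHarmonic ℓ m (dir (y - τ))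
  else 0

end Yukawa

end

noncomputable section

namespace Yukawa

/-! ### Spherical Bessel functions as power series -/

/-! By the binomial theorem the radial factor is `a Q r ^ ℓ (r² - R²) ^ n`, so inside the ball the
density is a combination of terms `(|x|² - R²) ^ n` times a solid harmonic. Everything follows from
this factored form.

Moments. Orthonormality of the `Y_L` (`sphereIntegral_sphHarmonic`) makes the map from coefficients
`Q` to moments diagonal. Its entries are the radial integrals of `integral_mul_sphBesselI`:
integrating the series of `i_ℓ` term by term against `r ^ (ℓ + 2) (r² - R²) ^ n` raises the Bessel
order from `ℓ` to `ℓ + n + 1`. They are nonzero because `i_ν` is positive on the positive axis, so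
the moments determine `Q` (`modMultipole_pseudoCharge`).

Fourier coefficients. The characters of the reciprocal lattice are lattice-periodic, so the integral
over the cell unfolds to one over space (`fourierCoefficient_periodize`). In the ball the
exponential is expanded in powers of `K · x`. The integral over the sphere of a degree `ℓ` harmonic
against `(K · u) ^ j` vanishes unless `j = ℓ + 2 s`, and is otherwise a multiple of the same
harmonic at `K`. The remaining radial integrals are those of the moment computation, now with
alternating signs, and sum to `j_ν` (`setIntegral_solidHarmonic_mul_exp`). At `K = 0` only `ℓ = 0`
survives.

Sphere integrals. A Gaussian integral in polar coordinates gives the integral of `(z · u) ^ j` for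
complex `z`. Replacing `z` by `w + t a` with `a · a = 0` and comparing powers of `t` gives the mixed
moments of `a · u` and `w · u`. The harmonics of degree `ℓ` are, up to constants, the coefficients
in `t` of `(nullVec t · u) ^ ℓ` (`harm`), so further comparisons of coefficients give both the
Funk–Hecke formula and orthogonality.

Boundary regularity. `R` is a root of multiplicity at least `n` of each radial polynomial, and
cutting off a polynomial at a root of multiplicity `k + 1` leaves a `C^k` function
(`contDiff_truncPoly`). -/

/-- The coefficient of `x ^ (ν + 2 s)` in the series of `i_ν(x)`. -/
def besselCoeff (ν s : ℕ) : ℝ := 1 / (2 ^ s * (s ! : ℝ) * ((2 * (ν + s) + 1)‼ : ℝ))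

lemma besselCoeff_pos (ν s : ℕ) : 0 < besselCoeff ν s := by
  have : 0 < (2 * (ν + s) + 1)‼ := Nat.doubleFactorial_pos _
  unfold besselCoeff
  positivity

lemma doubleFactorial_eq_mul_ascPochhammer (ν s : ℕ) :
    ((2 * (ν + s) + 1)‼ : ℝ) =
      ((2 * ν + 1)‼ : ℝ) * 2 ^ s * (ascPochhammer ℝ s).eval ((ν : ℝ) + 3 / 2) := by
  induction s with
  | zero => simp
  | succ s ih =>
    rw [show 2 * (ν + (s + 1)) + 1 = (2 * (ν + s) + 1) + 2 by ring, Nat.doubleFactorial_add_two,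
      ascPochhammer_succ_right]
    push_cast
    rw [ih]
    simp only [eval_mul, eval_add, eval_X, eval_natCast]
    ring

lemma besselCoeff_eq (ν s : ℕ) :
    besselCoeff ν s = 1 / ((2 * ν + 1)‼ : ℝ) *
      (1 / ((s ! : ℝ) * (ascPochhammer ℝ s).eval ((ν : ℝ) + 3 / 2)) * (1 / 2) ^ (2 * s)) := by
  rw [besselCoeff, doubleFactorial_eq_mul_ascPochhammer, pow_mul, one_div_pow 2 2, one_div_pow,
    show (2 : ℝ) ^ 2 = 2 * 2 by norm_num, mul_pow]
  simp only [one_div, mul_inv]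
  ring

lemma sphBesselI_eq_tsum (ν : ℕ) (x : ℝ) :
    sphBesselI ν x = ∑' s, besselCoeff ν s * x ^ (ν + 2 * s) := by
  rw [sphBesselI, ← tsum_mul_left]
  refine tsum_congr fun s => ?_
  rw [besselCoeff_eq, div_pow, pow_add, one_div_pow]
  ring

lemma sphBesselJ_eq_tsum (ν : ℕ) (x : ℝ) :
    sphBesselJ ν x = ∑' s, (-1) ^ s * besselCoeff ν s * x ^ (ν + 2 * s) := by
  rw [sphBesselJ, ← tsum_mul_left]
  refine tsum_congr fun s => ?_
  rw [besselCoeff_eq, div_pow, pow_add, one_div_pow]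
  ring

/-- Crude, but enough to dominate the Bessel series by the exponential series in `x ^ 2`. -/
lemma besselCoeff_le (ν s : ℕ) : besselCoeff ν s ≤ 1 / (s ! : ℝ) := by
  have h1 : (1 : ℝ) ≤ ((2 * (ν + s) + 1)‼ : ℝ) := by
    exact_mod_cast Nat.doubleFactorial_pos _
  have h2 : (1 : ℝ) ≤ 2 ^ s := one_le_pow₀ (by norm_num)
  have h3 : (0 : ℝ) < s ! := by positivity
  rw [besselCoeff]
  apply one_div_le_one_div_of_le h3
  nlinarith [mul_le_mul h2 h1 zero_le_one (by positivity)]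

lemma summable_besselCoeff (ν : ℕ) (x : ℝ) :
    Summable fun s => besselCoeff ν s * x ^ (ν + 2 * s) := by
  refine Summable.of_norm_bounded
    (g := fun s => |x| ^ ν * ((x ^ 2) ^ s / (s ! : ℝ))) ?_ fun s => ?_
  · exact (Real.summable_pow_div_factorial (x ^ 2)).mul_left _
  · rw [norm_mul, Real.norm_of_nonneg (besselCoeff_pos ν s).le, norm_pow, Real.norm_eq_abs,
      pow_add, pow_mul, sq_abs]
    calc _ ≤ 1 / (s ! : ℝ) * (|x| ^ ν * (x ^ 2) ^ s) := by
          gcongr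
          exact besselCoeff_le ν s
      _ = _ := by ring

lemma sphBesselI_pos (ν : ℕ) {x : ℝ} (hx : 0 < x) : 0 < sphBesselI ν x := by
  rw [sphBesselI_eq_tsum]
  have h : ∀ s, 0 < besselCoeff ν s * x ^ (ν + 2 * s) :=
    fun s => mul_pos (besselCoeff_pos ν s) (by positivity)
  exact (summable_besselCoeff ν x).tsum_pos (fun s => (h s).le) 0 (h 0)

lemma continuous_sphBesselI (ν : ℕ) : Continuous (sphBesselI ν) := by
  rw [continuous_iff_continuousAt]
  intro x
  have hx : Metric.ball (0 : ℝ) (|x| + 1) ∈ nhds x :=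
    Metric.isOpen_ball.mem_nhds (by simp)
  refine ContinuousOn.continuousAt ?_ hx
  rw [funext (sphBesselI_eq_tsum ν)]
  refine continuousOn_tsum (u := fun s => besselCoeff ν s * (|x| + 1) ^ (ν + 2 * s))
    (fun s => by fun_prop) (summable_besselCoeff ν _) fun s y hy => ?_
  have hy' : |y| ≤ |x| + 1 := by simpa using (mem_ball_zero_iff.1 hy).le
  rw [norm_mul, Real.norm_of_nonneg (besselCoeff_pos ν s).le, norm_pow, Real.norm_eq_abs]
  have := (besselCoeff_pos ν s).le
  gcongr

/-! ### Radial integrals -/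

lemma integral_pow_mul_sq_sub_sq_pow (R : ℝ) (n p : ℕ) :
    ∫ r in (0 : ℝ)..R, r ^ (2 * (p + 1)) * (r ^ 2 - R ^ 2) ^ n =
      (-2) ^ n * (n ! : ℝ) * R ^ (2 * (p + n) + 3) * ((2 * p + 1)‼ : ℝ) /
        ((2 * (p + n) + 3)‼ : ℝ) := by
  induction n generalizing p with
  | zero =>
    have h : (0 : ℝ) < ((2 * p + 1)‼ : ℝ) := by exact_mod_cast Nat.doubleFactorial_pos _
    rw [show 2 * (p + 0) + 3 = (2 * p + 1) + 2 by ring, Nat.doubleFactorial_add_two]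
    simp only [pow_zero, mul_one, integral_pow]
    push_cast
    rw [show 2 * (p + 1) + 1 = 2 * p + 1 + 2 by ring]
    simp only [ne_eq, Nat.add_eq_zero_iff, OfNat.ofNat_ne_zero, and_false, not_false_eq_true,
      zero_pow, Nat.factorial_zero, Nat.cast_one]
    field_simp
    ring
  | succ n ih =>
    -- This product vanishes at both `0` and `R`, so integrating its derivative trades one factor
    -- `r² - R²` for a step from `p` to `p + 1`; hence the induction with `p` general.
    have hd : ∀ r : ℝ, HasDerivAt (fun r : ℝ => r ^ (2 * p + 3) * (r ^ 2 - R ^ 2) ^ (n + 1))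
        ((2 * p + 3) * (r ^ (2 * (p + 1)) * (r ^ 2 - R ^ 2) ^ (n + 1)) +
          2 * (n + 1) * (r ^ (2 * (p + 1 + 1)) * (r ^ 2 - R ^ 2) ^ n)) r := by
      intro r
      convert! (hasDerivAt_pow (2 * p + 3) r).mul
        (((hasDerivAt_pow 2 r).sub_const (R ^ 2)).pow (n + 1)) using 1
      push_cast
      simp only [Pi.pow_apply]
      ring
    have hint := intervalIntegral.integral_eq_sub_of_hasDerivAt (a := 0) (b := R)
      (fun r _ => hd r) (by apply Continuous.intervalIntegrable; fun_prop)
    rw [intervalIntegral.integral_add (by apply Continuous.intervalIntegrable; fun_prop)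
      (by apply Continuous.intervalIntegrable; fun_prop),
      intervalIntegral.integral_const_mul, intervalIntegral.integral_const_mul, ih (p + 1)] at hint
    simp only [sub_self, ne_eq, Nat.add_eq_zero_iff, one_ne_zero, and_false, not_false_eq_true,
      zero_pow, mul_zero, OfNat.ofNat_ne_zero, zero_mul] at hint
    have hne : (2 * (p : ℝ) + 3) ≠ 0 := by positivity
    apply mul_left_cancel₀ hne
    rw [show 2 * (p + (n + 1)) + 3 = 2 * (p + 1 + n) + 3 by ring, eq_neg_of_add_eq_zero_left hint,
      show 2 * (p + 1) + 1 = (2 * p + 1) + 2 by ring, Nat.doubleFactorial_add_two,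
      Nat.factorial_succ]
    push_cast
    ring

/-- The radial integral replaces the factor `(2 (ℓ + s) + 1)‼` in the coefficient by `(2 (ℓ + n + 1
+ s) + 1)‼`, with a prefactor independent of `s`. The `s`-th term of order `ℓ` thus goes to the
`s`-th term of order `ℓ + n + 1`, which serves both `i_ν` and `j_ν`. -/
lemma besselCoeff_mul_integral (R κ : ℝ) (hκ : κ ≠ 0) (ℓ n s : ℕ) :
    besselCoeff ℓ s * κ ^ (ℓ + 2 * s) *
        ∫ r in (0 : ℝ)..R, r ^ (2 * (ℓ + s + 1)) * (r ^ 2 - R ^ 2) ^ n =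
      (-2) ^ n * (n ! : ℝ) * R ^ (ℓ + n + 2) / κ ^ (n + 1) *
        (besselCoeff (ℓ + n + 1) s * (κ * R) ^ (ℓ + n + 1 + 2 * s)) := by
  have h1 : (0 : ℝ) < ((2 * (ℓ + s) + 1)‼ : ℝ) := by exact_mod_cast Nat.doubleFactorial_pos _
  have h2 : (0 : ℝ) < ((2 * (ℓ + n + 1 + s) + 1)‼ : ℝ) := by
    exact_mod_cast Nat.doubleFactorial_pos _
  have h3 : (0 : ℝ) < s ! := by positivity
  rw [integral_pow_mul_sq_sub_sq_pow, besselCoeff, besselCoeff,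
    show 2 * (ℓ + s + n) + 3 = 2 * (ℓ + n + 1 + s) + 1 by ring]
  field_simp
  ring

lemma integral_mul_sphBesselI (R κ : ℝ) (hR : 0 ≤ R) (hκ : 0 < κ) (ℓ n : ℕ) :
    ∫ r in (0 : ℝ)..R, r ^ (ℓ + 2) * (r ^ 2 - R ^ 2) ^ n * sphBesselI ℓ (κ * r) =
      (-2) ^ n * (n ! : ℝ) * R ^ (ℓ + n + 2) / κ ^ (n + 1) * sphBesselI (ℓ + n + 1) (κ * R) := by
  set f : ℝ → ℝ := fun r => r ^ (ℓ + 2) * (r ^ 2 - R ^ 2) ^ n with hf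
  have hs := intervalIntegral.hasSum_integral_of_dominated_convergence (a := 0) (b := R)
    (μ := volume) (F := fun s r => f r * (besselCoeff ℓ s * (κ * r) ^ (ℓ + 2 * s)))
    (f := fun r => f r * sphBesselI ℓ (κ * r))
    (fun s r => |f r| * (besselCoeff ℓ s * (κ * r) ^ (ℓ + 2 * s)))
    (fun s => by apply Continuous.aestronglyMeasurable; fun_prop)
    (fun s => by
      refine Filter.Eventually.of_forall fun r hr => ?_
      rw [Set.uIoc_of_le hR] at hr
      have h0 : 0 ≤ κ * r := mul_nonneg hκ.le hr.1.le
      rw [norm_mul, Real.norm_eq_abs, Real.norm_of_nonneg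
        (mul_nonneg (besselCoeff_pos ℓ s).le (by positivity))])
    (Filter.Eventually.of_forall fun r _ => (summable_besselCoeff ℓ _).mul_left _)
    (by
      simp_rw [tsum_mul_left, ← sphBesselI_eq_tsum]
      apply Continuous.intervalIntegrable
      have := continuous_sphBesselI ℓ
      fun_prop)
    (Filter.Eventually.of_forall fun r _ => by
      rw [sphBesselI_eq_tsum]
      exact (summable_besselCoeff ℓ _).hasSum.mul_left _)
  refine hs.unique ?_
  rw [sphBesselI_eq_tsum (ℓ + n + 1)]
  convert! ((summable_besselCoeff (ℓ + n + 1) (κ * R)).hasSum.mul_left _) using 2 with s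
  rw [← besselCoeff_mul_integral R κ hκ.ne', ← intervalIntegral.integral_const_mul]
  congr 1 with r
  rw [hf, mul_pow]
  ring

/-! ### Integration over the unit sphere -/

/-- The integral over the unit sphere with respect to the surface measure. -/
def sphereIntegral (h : E3 → ℂ) : ℂ :=
  ∫ u : Metric.sphere (0 : E3) 1, h u ∂((volume : Measure E3).toSphere)

lemma integrable_sphere {h : E3 → ℂ} (hh : Continuous h) :
    Integrable (fun u : Metric.sphere (0 : E3) 1 => h u) (volume : Measure E3).toSphere :=
  (hh.comp continuous_subtype_val).integrable_of_hasCompactSupport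
    (HasCompactSupport.of_compactSpace _)

lemma sphereIntegral_sum {ι : Type*} (s : Finset ι) (h : ι → E3 → ℂ)
    (hh : ∀ i ∈ s, Continuous (h i)) :
    sphereIntegral (fun u => ∑ i ∈ s, h i u) = ∑ i ∈ s, sphereIntegral (h i) :=
  integral_finsetSum s fun i hi => integrable_sphere (hh i hi)

lemma sphereIntegral_const_mul (c : ℂ) (h : E3 → ℂ) :
    sphereIntegral (fun u => c * h u) = c * sphereIntegral h :=
  integral_const_mul c _

lemma sphereIntegral_congr {h₁ h₂ : E3 → ℂ} (H : ∀ u : E3, ‖u‖ = 1 → h₁ u = h₂ u) :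
    sphereIntegral h₁ = sphereIntegral h₂ :=
  integral_congr_ae (Filter.Eventually.of_forall fun u => H u (by simp))

/-- Polar coordinates. The change of variables and the product formula hold for Bochner integrals
without integrability, so `F` and `h` are arbitrary. -/
lemma integral_radial_mul_dir (F : ℝ → ℂ) (h : E3 → ℂ) :
    ∫ x : E3, F ‖x‖ * h (dir x) =
      sphereIntegral h * ∫ r in Set.Ioi (0 : ℝ), (r : ℂ) ^ 2 * F r := by
  have hfin : Module.finrank ℝ E3 - 1 = 2 := by simp
  calc ∫ x : E3, F ‖x‖ * h (dir x)
      = ∫ x : ({(0)}ᶜ : Set E3), F ‖x.1‖ * h (dir x.1) ∂((volume : Measure E3).comap Subtype.val) := by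
        rw [integral_subtype_comap (measurableSet_singleton _).compl
          fun x : E3 => F ‖x‖ * h (dir x), restrict_compl_singleton]
    _ = ∫ p : Metric.sphere (0 : E3) 1 × Set.Ioi (0 : ℝ), h p.1 * F p.2
          ∂(volume : Measure E3).toSphere.prod (.volumeIoiPow 2) := by
        have := (volume : Measure E3).measurePreserving_homeomorphUnitSphereProd.integral_comp
          (Homeomorph.measurableEmbedding _)
          (fun p : Metric.sphere (0 : E3) 1 × Set.Ioi (0 : ℝ) => h p.1 * F p.2)
        rw [hfin] at this
        rw [← this]
        refine integral_congr_ae (Filter.Eventually.of_forall fun x => ?_)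
        simp [dir, mul_comm]
    _ = sphereIntegral h * ∫ r : Set.Ioi (0 : ℝ), F r ∂.volumeIoiPow 2 :=
        integral_prod_mul (fun u : Metric.sphere (0 : E3) 1 => h u)
          (fun r : Set.Ioi (0 : ℝ) => F r)
    _ = _ := by
        congr 1
        simp only [Measure.volumeIoiPow, ENNReal.ofReal]
        rw [integral_withDensity_eq_integral_smul,
          integral_subtype_comap measurableSet_Ioi fun a : ℝ => Real.toNNReal (a ^ 2) • F a,
          setIntegral_congr_fun measurableSet_Ioi fun x hx => ?_]
        · rw [NNReal.smul_def, Real.coe_toNNReal _ (pow_nonneg hx.out.le _)]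
          simp
        · exact (measurable_subtype_coe.pow_const _).real_toNNReal

lemma norm_smul_dir (x : E3) : ‖x‖ • dir x = x := by
  rcases eq_or_ne x 0 with rfl | hx
  · simp [dir]
  · rw [dir, smul_smul, mul_inv_cancel₀ (norm_ne_zero_iff.2 hx), one_smul]

lemma norm_dir {x : E3} (hx : x ≠ 0) : ‖dir x‖ = 1 := by
  rw [dir, norm_smul, norm_inv, norm_norm, inv_mul_cancel₀ (norm_ne_zero_iff.2 hx)]

lemma integral_radial_mul_homogeneous (F : ℝ → ℂ) (h : E3 → ℂ) (d : ℕ)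
    (hd : ∀ (r : ℝ) (x : E3), h (r • x) = (r : ℂ) ^ d * h x) :
    ∫ x : E3, F ‖x‖ * h x =
      sphereIntegral h * ∫ r in Set.Ioi (0 : ℝ), (r : ℂ) ^ (d + 2) * F r := by
  calc ∫ x : E3, F ‖x‖ * h x = ∫ x : E3, (F ‖x‖ * (‖x‖ : ℂ) ^ d) * h (dir x) := by
        congr 1 with x
        conv_lhs => rw [← norm_smul_dir x]
        rw [hd, norm_smul_dir]
        ring
    _ = _ := by
        rw [integral_radial_mul_dir (fun r => F r * (r : ℂ) ^ d) h]
        congr 2 with r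
        ring

lemma setIntegral_closedBall_radial_mul_dir {R : ℝ} (hR : 0 ≤ R) (F : ℝ → ℂ) (h : E3 → ℂ) :
    ∫ x in Metric.closedBall (0 : E3) R, F ‖x‖ * h (dir x) =
      sphereIntegral h * ∫ r in (0 : ℝ)..R, (r : ℂ) ^ 2 * F r := by
  rw [← integral_indicator Metric.isClosed_closedBall.measurableSet]
  have h1 : ∀ x : E3, (Metric.closedBall (0 : E3) R).indicator
      (fun x => F ‖x‖ * h (dir x)) x = (Set.Iic R).indicator F ‖x‖ * h (dir x) := by
    intro x
    by_cases hx : ‖x‖ ≤ R <;> simp [Set.indicator, hx]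
  simp_rw [h1]
  rw [integral_radial_mul_dir, intervalIntegral.integral_of_le hR]
  congr 1
  have h2 : ∀ r : ℝ, (r : ℂ) ^ 2 * (Set.Iic R).indicator F r =
      (Set.Iic R).indicator (fun r : ℝ => (r : ℂ) ^ 2 * F r) r := by
    intro r
    by_cases hr : r ≤ R <;> simp [Set.indicator, hr]
  simp_rw [h2]
  rw [setIntegral_indicator measurableSet_Iic, Set.Ioi_inter_Iic]

lemma setIntegral_closedBall_radial_mul_homogeneous {R : ℝ} (hR : 0 ≤ R) (F : ℝ → ℂ) (h : E3 → ℂ)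
    (d : ℕ) (hd : ∀ (r : ℝ) (x : E3), h (r • x) = (r : ℂ) ^ d * h x) :
    ∫ x in Metric.closedBall (0 : E3) R, F ‖x‖ * h x =
      sphereIntegral h * ∫ r in (0 : ℝ)..R, (r : ℂ) ^ (d + 2) * F r := by
  calc ∫ x in Metric.closedBall (0 : E3) R, F ‖x‖ * h x
      = ∫ x in Metric.closedBall (0 : E3) R, (F ‖x‖ * (‖x‖ : ℂ) ^ d) * h (dir x) := by
        congr 1 with x
        conv_lhs => rw [← norm_smul_dir x]
        rw [hd, norm_smul_dir]
        ring
    _ = _ := by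
        rw [setIntegral_closedBall_radial_mul_dir hR (fun r => F r * (r : ℂ) ^ d) h]
        congr 2 with r
        ring

/-! ### Moments of the sphere -/

/-- The bilinear pairing of a complex vector with a real one. -/
def cdot (z : Fin 3 → ℂ) (x : E3) : ℂ := ∑ i, z i * (x i : ℂ)

lemma continuous_cdot (z : Fin 3 → ℂ) : Continuous (cdot z) := by
  unfold cdot
  fun_prop

lemma cdot_smul (z : Fin 3 → ℂ) (r : ℝ) (x : E3) : cdot z (r • x) = r * cdot z x := by
  simp only [cdot, PiLp.smul_apply, smul_eq_mul, Complex.ofReal_mul, Finset.mul_sum]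
  exact Finset.sum_congr rfl fun i _ => by ring

lemma cdot_add_smul (z a : Fin 3 → ℂ) (t : ℂ) (x : E3) :
    cdot (z + t • a) x = cdot z x + t * cdot a x := by
  simp only [cdot, Pi.add_apply, Pi.smul_apply, smul_eq_mul, Finset.mul_sum,
    ← Finset.sum_add_distrib]
  exact Finset.sum_congr rfl fun i _ => by ring

lemma norm_cdot_le (z : Fin 3 → ℂ) (x : E3) : ‖cdot z x‖ ≤ (∑ i, ‖z i‖) * ‖x‖ := by
  rw [cdot, Finset.sum_mul]
  refine (norm_sum_le _ _).trans (Finset.sum_le_sum fun i _ => ?_)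
  rw [norm_mul, Complex.norm_real]
  gcongr
  exact PiLp.norm_apply_le x i

lemma integrable_exp_neg_sq_add (A : ℝ) :
    Integrable (fun x : E3 => rexp (-‖x‖ ^ 2 + A * ‖x‖)) := by
  have h := (GaussianFourier.integrable_cexp_neg_mul_sq_norm_add (b := 1 / 2) (by norm_num) 0
    (0 : E3)).norm.mul_const (rexp (A ^ 2 / 2))
  refine h.mono' (by apply Continuous.aestronglyMeasurable; fun_prop)
    (Filter.Eventually.of_forall fun x => ?_)
  have h1 : ‖Complex.exp (-(1 / 2) * (‖x‖ : ℂ) ^ 2 + 0 * ((inner ℝ (0 : E3) x : ℝ) : ℂ))‖ =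
      rexp (-(1 / 2) * ‖x‖ ^ 2) := by
    rw [Complex.norm_exp]
    congr 1
    simp [← Complex.ofReal_pow]
  rw [h1, Real.norm_of_nonneg (Real.exp_pos _).le, ← Real.exp_add]
  apply Real.exp_le_exp.2
  -- Completing the square: `A |x| ≤ |x|² / 2 + A² / 2`.
  nlinarith [sq_nonneg (‖x‖ - A)]

lemma integral_gaussian_mul_exp_cdot (z : Fin 3 → ℂ) :
    ∫ x : E3, (rexp (-‖x‖ ^ 2) : ℂ) * Complex.exp (cdot z x) =
      (π : ℂ) ^ (3 / 2 : ℂ) * Complex.exp ((∑ i, z i ^ 2) / 4) := by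
  have h := GaussianFourier.integral_cexp_neg_mul_sum_add (b := 1) (by norm_num) z
  simp only [Fintype.card_fin, div_one, mul_one, Nat.cast_ofNat] at h
  rw [← h, ← (PiLp.volume_preserving_toLp (Fin 3)).integral_comp
    (MeasurableEquiv.toLp 2 _).measurableEmbedding]
  congr 1 with x
  rw [Complex.ofReal_exp, ← Complex.exp_add]
  congr 2
  simp [EuclideanSpace.norm_sq_eq]

lemma hasSum_gaussian_moments (z : Fin 3 → ℂ) :
    HasSum (fun j : ℕ => (∫ x : E3, (rexp (-‖x‖ ^ 2) : ℂ) * cdot z x ^ j) / (j ! : ℂ))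
      ((π : ℂ) ^ (3 / 2 : ℂ) * Complex.exp ((∑ i, z i ^ 2) / 4)) := by
  set A := ∑ i, ‖z i‖ with hA
  have hbound : ∀ x : E3, HasSum (fun j : ℕ => rexp (-‖x‖ ^ 2) * ((A * ‖x‖) ^ j / (j ! : ℝ)))
      (rexp (-‖x‖ ^ 2 + A * ‖x‖)) := by
    intro x
    rw [Real.exp_add, Real.exp_eq_exp_ℝ]
    exact (NormedSpace.expSeries_div_hasSum_exp (𝔸 := ℝ) (A * ‖x‖)).mul_left _
  have h := hasSum_integral_of_dominated_convergence (μ := (volume : Measure E3))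
    (F := fun (j : ℕ) x => (rexp (-‖x‖ ^ 2) : ℂ) * (cdot z x ^ j / (j ! : ℂ)))
    (f := fun x => (rexp (-‖x‖ ^ 2) : ℂ) * Complex.exp (cdot z x))
    (fun j x => rexp (-‖x‖ ^ 2) * ((A * ‖x‖) ^ j / (j ! : ℝ)))
    (fun j => by
      have := continuous_cdot z
      apply Continuous.aestronglyMeasurable
      fun_prop)
    (fun j => Filter.Eventually.of_forall fun x => by
      rw [norm_mul, norm_div, norm_pow, Complex.norm_real, Complex.norm_natCast,
        Real.norm_of_nonneg (Real.exp_pos _).le]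
      gcongr
      exact norm_cdot_le z x)
    (Filter.Eventually.of_forall fun x => (hbound x).summable)
    (by
      simp_rw [fun x => (hbound x).tsum_eq]
      exact integrable_exp_neg_sq_add A)
    (Filter.Eventually.of_forall fun x => by
      rw [Complex.exp_eq_exp_ℂ]
      exact (NormedSpace.expSeries_div_hasSum_exp (𝔸 := ℂ) (cdot z x)).mul_left _)
  rw [integral_gaussian_mul_exp_cdot] at h
  convert! h using 2 with j
  simp_rw [← mul_div_assoc]
  rw [integral_div]

/-- Uniqueness of power series coefficients, used to read off the Gaussian moments from the Gaussian
integral. -/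
lemma eq_of_hasSum_pow {f : ℂ → ℂ} {a b : ℕ → ℂ}
    (ha : ∀ t : ℂ, HasSum (fun j => t ^ j * a j) (f t))
    (hb : ∀ t : ℂ, HasSum (fun j => t ^ j * b j) (f t)) : a = b := by
  have key : ∀ c : ℕ → ℂ, (∀ t : ℂ, HasSum (fun j => t ^ j * c j) (f t)) →
      HasFPowerSeriesAt f (FormalMultilinearSeries.ofScalars ℂ c) 0 := by
    intro c hc
    rw [hasFPowerSeriesAt_iff]
    refine Filter.Eventually.of_forall fun t => ?_
    simpa [FormalMultilinearSeries.coeff_ofScalars] using hc t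
  have h := (key a ha).eq_formalMultilinearSeries (key b hb)
  funext j
  have := congrArg (fun p => FormalMultilinearSeries.coeff p j) h
  simpa [FormalMultilinearSeries.coeff_ofScalars] using this

/-- Scaling `z` by `t` turns the Gaussian integral into `π ^ (3/2) exp (t² (z · z) / 4)`; the
moments are its coefficients in `t`. -/
lemma gaussian_moments (z : Fin 3 → ℂ) (j : ℕ) :
    (∫ x : E3, (rexp (-‖x‖ ^ 2) : ℂ) * cdot z x ^ j) / (j ! : ℂ) =
      if Even j then (π : ℂ) ^ (3 / 2 : ℂ) *
        (((∑ i, z i ^ 2) / 4) ^ (j / 2) / ((j / 2)! : ℂ)) else 0 := by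
  refine congrFun (eq_of_hasSum_pow
    (a := fun j : ℕ => (∫ x : E3, (rexp (-‖x‖ ^ 2) : ℂ) * cdot z x ^ j) / (j ! : ℂ))
    (b := fun j : ℕ => if Even j then (π : ℂ) ^ (3 / 2 : ℂ) *
        (((∑ i, z i ^ 2) / 4) ^ (j / 2) / ((j / 2)! : ℂ)) else 0)
    (f := fun t => (π : ℂ) ^ (3 / 2 : ℂ) * Complex.exp (t ^ 2 * ((∑ i, z i ^ 2) / 4)))
    (fun t => ?_) (fun t => ?_)) j
  · convert! hasSum_gaussian_moments (t • z) using 2 with j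
    · rw [← mul_div_assoc, ← integral_const_mul]
      congr 2 with x
      have : cdot (t • z) x = t * cdot z x := by
        simpa [cdot] using cdot_add_smul 0 z t x
      rw [this]
      ring
    · simp [mul_pow, Finset.mul_sum, mul_div_assoc, Finset.sum_div]
  · have hinj : Function.Injective (fun p : ℕ => 2 * p) := fun p q h => by simpa using h
    rw [← hinj.hasSum_iff]
    · have := (NormedSpace.expSeries_div_hasSum_exp (𝔸 := ℂ)
        (t ^ 2 * ((∑ i, z i ^ 2) / 4))).mul_left ((π : ℂ) ^ (3 / 2 : ℂ))
      rw [← Complex.exp_eq_exp_ℂ] at this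
      convert! this using 2 with p
      simp only [Function.comp_apply, even_two, Even.mul_right, if_true, ne_eq,
        OfNat.ofNat_ne_zero, not_false_eq_true, mul_div_cancel_left₀, pow_mul]
      ring
    · intro j hj
      rw [if_neg, mul_zero]
      intro he
      exact hj ⟨j / 2, Nat.two_mul_div_two_of_even he⟩

lemma integral_pow_mul_exp_neg_sq (j : ℕ) :
    ∫ r in Set.Ioi (0 : ℝ), (r : ℂ) ^ (j + 2) * (rexp (-r ^ 2) : ℂ) =
      ((1 / 2 * Real.Gamma ((j + 3) / 2) : ℝ) : ℂ) := by
  have h := integral_rpow_mul_exp_neg_rpow (p := 2) (q := ((j + 2 : ℕ) : ℝ)) (by norm_num)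
    (by push_cast; linarith [(Nat.cast_nonneg j : (0 : ℝ) ≤ j)])
  simp only [Real.rpow_natCast, Real.rpow_two] at h
  rw [show (((j + 2 : ℕ) : ℝ) + 1) / 2 = (j + 3) / 2 by push_cast; ring] at h
  rw [← h, ← integral_complex_ofReal]
  push_cast
  rfl

/-- In polar coordinates the Gaussian moment is this integral times the radial factor `Γ((j + 3) /
2) / 2`, which is positive and can be divided out. -/
lemma sphereIntegral_cdot_pow (z : Fin 3 → ℂ) (j : ℕ) :
    sphereIntegral (fun u => cdot z u ^ j) =
      if Even j then 4 * π / (j + 1) * (∑ i, z i ^ 2) ^ (j / 2) else 0 := by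
  have h1 := integral_radial_mul_homogeneous (fun r => (rexp (-r ^ 2) : ℂ))
    (fun x => cdot z x ^ j) j (fun r x => by rw [cdot_smul, mul_pow])
  have hj : (j ! : ℂ) ≠ 0 := by exact_mod_cast (Nat.factorial_pos j).ne'
  have h2 := gaussian_moments z j
  rw [h1, integral_pow_mul_exp_neg_sq, div_eq_iff hj] at h2
  have hG : 0 < Real.Gamma ((j + 3) / 2) := Real.Gamma_pos_of_pos (by positivity)
  have hG' : ((1 / 2 * Real.Gamma ((j + 3) / 2) : ℝ) : ℂ) ≠ 0 := by
    exact_mod_cast (by positivity)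
  apply mul_right_cancel₀ hG'
  rw [h2]
  split_ifs with he
  · obtain ⟨p, rfl⟩ := he
    have hp : ((p + p : ℕ) + 3 : ℝ) / 2 = ((p + 1 : ℕ) : ℝ) + 1 / 2 := by
      push_cast
      ring
    have hpi : (π : ℂ) ^ (3 / 2 : ℂ) = π * (√π : ℂ) := by
      rw [show (3 / 2 : ℂ) = 1 + 1 / 2 by norm_num, Complex.cpow_add _ _
        (by exact_mod_cast Real.pi_ne_zero), Complex.cpow_one, Real.sqrt_eq_rpow,
        Complex.ofReal_cpow Real.pi_pos.le]
      norm_num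
    have hfac := Nat.factorial_eq_mul_doubleFactorial (2 * p)
    rw [Nat.doubleFactorial_two_mul, Nat.factorial_succ] at hfac
    have hfac' : ((2 * p : ℕ) + 1 : ℂ) * ((2 * p)! : ℂ) =
        ((2 * p + 1)‼ : ℂ) * (2 ^ p * (p ! : ℂ)) := by exact_mod_cast hfac
    rw [hp, Real.Gamma_nat_add_half, ← two_mul, Nat.mul_div_cancel_left _ two_pos, hpi, div_pow,
      show 2 * (p + 1) - 1 = 2 * p + 1 by omega]
    have h3 : (p ! : ℂ) ≠ 0 := by exact_mod_cast (Nat.factorial_pos p).ne'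
    have h4 : ((2 * p : ℕ) + 1 : ℂ) ≠ 0 := Nat.cast_add_one_ne_zero (2 * p)
    have h5 : (4 : ℂ) ^ p = 2 ^ p * 2 ^ p := by rw [← mul_pow]; norm_num
    push_cast at hfac' h4 ⊢
    rw [h5]
    field_simp
    linear_combination 4 * 2 ^ p * (∑ i, z i ^ 2) ^ p * hfac'
  · rw [zero_mul, zero_mul]

lemma coeff_eq_of_forall_sum_eq {A B : ℕ} {a b : ℕ → ℂ}
    (h : ∀ t : ℂ, ∑ p ∈ Finset.range A, a p * t ^ p = ∑ p ∈ Finset.range B, b p * t ^ p) (p : ℕ) :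
    (if p < A then a p else 0) = if p < B then b p else 0 := by
  have : (∑ p ∈ Finset.range A, C (a p) * X ^ p : ℂ[X]) =
      ∑ p ∈ Finset.range B, C (b p) * X ^ p := by
    apply Polynomial.funext
    intro t
    simpa [eval_finsetSum] using h t
  simpa [finsetSum_coeff, coeff_C_mul_X_pow] using congrArg (fun q => q.coeff p) this

/-- Since `a · a = 0`, the square of `w + t a` is affine in `t`: it equals `2 t (a · w) + w · w`.
Both sides are the coefficient of `t ^ ℓ` in the integral of `((w + t a) · u) ^ (ℓ + j)`. -/
lemma choose_mul_sphereIntegral (a w : Fin 3 → ℂ) (ha : ∑ i, a i ^ 2 = 0) (ℓ j : ℕ) :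
    ((ℓ + j).choose ℓ : ℂ) * sphereIntegral (fun u => cdot a u ^ ℓ * cdot w u ^ j) =
      if Even (ℓ + j) ∧ ℓ ≤ j then
        4 * π / (ℓ + j + 1) * ((((ℓ + j) / 2).choose ℓ : ℂ) *
          (2 * ∑ i, a i * w i) ^ ℓ * (∑ i, w i ^ 2) ^ ((ℓ + j) / 2 - ℓ)) else 0 := by
  set N := ℓ + j with hN
  have hz : ∀ t : ℂ, ∑ i, (w + t • a) i ^ 2 = t * (2 * ∑ i, a i * w i) + ∑ i, w i ^ 2 := by
    intro t
    simp only [Fin.sum_univ_three, Pi.add_apply, Pi.smul_apply, smul_eq_mul] at ha ⊢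
    linear_combination t ^ 2 * ha
  have hL : ∀ t : ℂ, sphereIntegral (fun u => cdot (w + t • a) u ^ N) =
      ∑ p ∈ Finset.range (N + 1),
        ((N.choose p : ℂ) * sphereIntegral (fun u => cdot a u ^ p * cdot w u ^ (N - p))) *
          t ^ p := by
    intro t
    have hca := continuous_cdot a
    have hcw := continuous_cdot w
    calc _ = sphereIntegral (fun u => ∑ p ∈ Finset.range (N + 1),
          ((N.choose p : ℂ) * t ^ p) * (cdot a u ^ p * cdot w u ^ (N - p))) := by
            congr 1
            funext u
            rw [cdot_add_smul, add_comm, add_pow]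
            exact Finset.sum_congr rfl fun p _ => by ring
      _ = _ := by
            rw [sphereIntegral_sum _ _ fun p _ => by fun_prop]
            refine Finset.sum_congr rfl fun p _ => ?_
            rw [sphereIntegral_const_mul]
            ring
  have hNj : N - ℓ = j := by omega
  by_cases he : Even N
  · have key := coeff_eq_of_forall_sum_eq (A := N + 1) (B := N / 2 + 1)
      (a := fun p => (N.choose p : ℂ) *
        sphereIntegral (fun u => cdot a u ^ p * cdot w u ^ (N - p)))
      (b := fun p => 4 * π / (N + 1) * (((N / 2).choose p : ℂ) *
          (2 * ∑ i, a i * w i) ^ p * (∑ i, w i ^ 2) ^ (N / 2 - p))) (fun t => by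
        rw [← hL, sphereIntegral_cdot_pow, if_pos he, hz, add_pow, Finset.mul_sum]
        exact Finset.sum_congr rfl fun p _ => by ring) ℓ
    simp only [hNj] at key
    rw [if_pos (by omega)] at key
    rw [key]
    -- The right-hand polynomial has degree at most `N / 2`; for even `N = ℓ + j`, `ℓ ≤ N / 2` says
    -- `ℓ ≤ j`.
    have hiff : ℓ < N / 2 + 1 ↔ Even N ∧ ℓ ≤ j := by
      rw [and_iff_right he]
      omega
    rw [if_congr hiff rfl rfl]
    simp only [hN, Nat.cast_add]
  · have key := coeff_eq_of_forall_sum_eq (A := N + 1) (B := 0)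
      (a := fun p => (N.choose p : ℂ) *
        sphereIntegral (fun u => cdot a u ^ p * cdot w u ^ (N - p)))
      (b := fun p => 0) (fun t => by
        rw [← hL, sphereIntegral_cdot_pow, if_neg he]
        simp) ℓ
    simp only [hNj] at key
    rw [if_pos (by omega), if_neg (by omega)] at key
    rw [key, if_neg (by tauto)]

lemma sphereIntegral_null_pow_mul_pow (a w : Fin 3 → ℂ) (ha : ∑ i, a i ^ 2 = 0) (ℓ s : ℕ) :
    sphereIntegral (fun u => cdot a u ^ ℓ * cdot w u ^ (ℓ + 2 * s)) =
      4 * π * ((ℓ + 2 * s)! : ℂ) * (besselCoeff ℓ s : ℂ) * (∑ i, a i * w i) ^ ℓ *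
        (∑ i, w i ^ 2) ^ s := by
  have h := choose_mul_sphereIntegral a w ha ℓ (ℓ + 2 * s)
  have hN : ℓ + (ℓ + 2 * s) = 2 * (ℓ + s) := by ring
  rw [if_pos ⟨by rw [hN]; simp, by omega⟩] at h
  have hc1 := Nat.add_choose_mul_factorial_mul_factorial ℓ (ℓ + 2 * s)
  have hc2 := Nat.add_choose_mul_factorial_mul_factorial ℓ s
  have hfac := Nat.factorial_eq_mul_doubleFactorial (2 * (ℓ + s))
  rw [Nat.doubleFactorial_two_mul, Nat.factorial_succ] at hfac
  rw [← Nat.choose_symm_add, hN] at hc1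
  rw [← Nat.choose_symm_add] at hc2
  rw [hN] at h
  rw [Nat.mul_div_cancel_left _ two_pos, show ℓ + s - ℓ = s by omega] at h
  have hc1' : ((2 * (ℓ + s)).choose ℓ : ℂ) * (ℓ ! : ℂ) * ((ℓ + 2 * s)! : ℂ) =
    ((2 * (ℓ + s))! : ℂ) := by exact_mod_cast hc1
  have hc2' : ((ℓ + s).choose ℓ : ℂ) * (ℓ ! : ℂ) * (s ! : ℂ) = ((ℓ + s)! : ℂ) := by
    exact_mod_cast hc2
  have hfac' : ((2 * (ℓ + s) + 1 : ℕ) : ℂ) * ((2 * (ℓ + s))! : ℂ) =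
        ((2 * (ℓ + s) + 1)‼ : ℂ) * (2 ^ (ℓ + s) * ((ℓ + s)! : ℂ)) := by exact_mod_cast hfac
  have n1 : ((2 * (ℓ + s)).choose ℓ : ℂ) ≠ 0 := by
    exact_mod_cast (Nat.choose_pos (by omega)).ne'
  have n2 : (ℓ ! : ℂ) ≠ 0 := by exact_mod_cast (Nat.factorial_pos ℓ).ne'
  have n3 : (s ! : ℂ) ≠ 0 := by exact_mod_cast (Nat.factorial_pos s).ne'
  have n4 : ((2 * (ℓ + s) + 1)‼ : ℂ) ≠ 0 := by
    exact_mod_cast (Nat.doubleFactorial_pos _).ne'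
  have n5 : ((2 * (ℓ + s) + 1 : ℕ) : ℂ) ≠ 0 := Nat.cast_ne_zero.2 (Nat.succ_ne_zero _)
  apply mul_left_cancel₀ n1
  rw [h, besselCoeff]
  have hN' : (ℓ : ℂ) + ((ℓ + 2 * s : ℕ) : ℂ) + 1 = ((2 * (ℓ + s) + 1 : ℕ) : ℂ) := by
    push_cast
    ring
  rw [hN', mul_pow]
  push_cast
  set D := ((2 * (ℓ + s) + 1)‼ : ℂ)
  set n := ((2 * (ℓ + s) + 1 : ℕ) : ℂ) with hn
  have hn' : (2 * ((ℓ : ℂ) + s) + 1) = n := by rw [hn]; push_cast; ring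
  rw [hn']
  set P := (∑ i, a i * w i) ^ ℓ * (∑ i, w i ^ 2) ^ s with hP
  have e1 : ((ℓ + s).choose ℓ : ℂ) * 2 ^ ℓ * (2 ^ s * s ! * D) * ℓ ! =
      ((2 * (ℓ + s)).choose ℓ : ℂ) * ((ℓ + 2 * s)! : ℂ) * n * ℓ ! := by
    rw [pow_add] at hfac'
    linear_combination 2 ^ ℓ * 2 ^ s * D * hc2' - hfac' - n * hc1'
  have e2 := mul_right_cancel₀ n2 e1
  field_simp
  linear_combination P * e2

lemma sphereIntegral_null_pow_mul_pow_eq_zero (a w : Fin 3 → ℂ) (ha : ∑ i, a i ^ 2 = 0) (ℓ j : ℕ)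
    (hj : ∀ s, j ≠ ℓ + 2 * s) :
    sphereIntegral (fun u => cdot a u ^ ℓ * cdot w u ^ j) = 0 := by
  have h := choose_mul_sphereIntegral a w ha ℓ j
  rw [if_neg] at h
  · have n1 : ((ℓ + j).choose ℓ : ℂ) ≠ 0 := by
      exact_mod_cast (Nat.choose_pos (by omega)).ne'
    exact (mul_eq_zero.1 h).resolve_left n1
  · rintro ⟨⟨p, hp⟩, h2⟩
    exact hj (p - ℓ) (by omega)

/-! ### Spherical harmonics as coefficients of powers of a null form -/

/-- A real vector, viewed as a complex one. -/
def toC (x : E3) : Fin 3 → ℂ := fun i => (x i : ℂ)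

/-- An isotropic vector of `ℂ³`. -/
def nullVec (t : ℂ) : Fin 3 → ℂ := ![t ^ 2 - 1, Complex.I * (t ^ 2 + 1), 2 * t]

lemma sum_nullVec_sq (t : ℂ) : ∑ i, nullVec t i ^ 2 = 0 := by
  simp only [nullVec, Fin.sum_univ_three, Matrix.cons_val]
  linear_combination (t ^ 2 + 1) ^ 2 * Complex.I_sq

/-- The pairing of `w` with `nullVec t`, as a polynomial in `t`. -/
def nullForm (w : Fin 3 → ℂ) : ℂ[X] :=
  C (w 0 + Complex.I * w 1) * X ^ 2 + C (2 * w 2) * X - C (w 0 - Complex.I * w 1)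

lemma eval_nullForm (w : Fin 3 → ℂ) (t : ℂ) :
    (nullForm w).eval t = ∑ i, nullVec t i * w i := by
  simp only [nullForm, nullVec, Fin.sum_univ_three, Matrix.cons_val, eval_sub, eval_add, eval_mul,
    eval_C, eval_pow, eval_X]
  ring

lemma natDegree_nullForm_le (w : Fin 3 → ℂ) : (nullForm w).natDegree ≤ 2 := by
  unfold nullForm
  compute_degree

/-- The coefficient of `t ^ k` in the `ℓ`-th power of the null form; as a function of `w` this is
a homogeneous harmonic polynomial of degree `ℓ`. -/
def harm (ℓ k : ℕ) (w : Fin 3 → ℂ) : ℂ := (nullForm w ^ ℓ).coeff k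

lemma sum_harm_mul_pow (ℓ : ℕ) (w : Fin 3 → ℂ) (t : ℂ) :
    ∑ k ∈ Finset.range (2 * ℓ + 1), harm ℓ k w * t ^ k = (∑ i, nullVec t i * w i) ^ ℓ := by
  rw [← eval_nullForm, ← eval_pow, eval_eq_sum_range' (n := 2 * ℓ + 1)]
  · rfl
  · have := natDegree_pow_le_of_le ℓ (natDegree_nullForm_le w)
    omega

lemma harm_smul (ℓ k : ℕ) (c : ℂ) (w : Fin 3 → ℂ) : harm ℓ k (c • w) = c ^ ℓ * harm ℓ k w := by
  have : nullForm (c • w) = C c * nullForm w := by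
    simp only [nullForm, Pi.smul_apply, smul_eq_mul, C_add, C_mul, C_sub]
    ring
  rw [harm, this, mul_pow, ← C_pow, coeff_C_mul, harm]

lemma toC_smul (r : ℝ) (x : E3) : toC (r • x) = (r : ℂ) • toC x := by
  funext i
  simp [toC]

lemma continuous_harm (ℓ k : ℕ) : Continuous (harm ℓ k) := by
  have h1 : ∀ k, Continuous fun w : Fin 3 → ℂ => (nullForm w).coeff k := by
    intro k
    simp only [nullForm, coeff_sub, coeff_add, coeff_C_mul, coeff_C]
    split_ifs <;> fun_prop
  induction ℓ generalizing k with
  | zero =>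
    unfold harm
    simpa only [pow_zero] using continuous_const
  | succ ℓ ih =>
    unfold harm at ih ⊢
    simp only [pow_succ, coeff_mul]
    exact continuous_finsetSum _ fun p _ => (ih p.1).mul (h1 p.2)

lemma continuous_toC : Continuous toC := by
  unfold toC
  fun_prop

lemma harm_eq_zero {ℓ k : ℕ} (hk : 2 * ℓ < k) (w : Fin 3 → ℂ) : harm ℓ k w = 0 := by
  have := natDegree_pow_le_of_le ℓ (natDegree_nullForm_le w)
  exact coeff_eq_zero_of_natDegree_lt (by omega)

/-- For real `x` the coefficients are `ρ, 2 x₂, -conj ρ` with `ρ = x₀ + i x₁`. Conjugation amounts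
to reversing them, changing the sign of the variable and changing the overall sign. -/
lemma reflect_nullForm (x : E3) :
    (nullForm (toC x)).map (starRingEnd ℂ) =
      -(reflect 2 (nullForm (toC x))).comp (C (-1) * X) := by
  ext n
  rw [coeff_neg, comp_C_mul_X_coeff, coeff_reflect, coeff_map]
  rcases lt_or_ge 2 n with hn | hn
  · rw [revAt_eq_self_of_lt hn, coeff_eq_zero_of_natDegree_lt
      ((natDegree_nullForm_le _).trans_lt hn)]
    simp
  · rw [revAt_le hn]
    simp only [nullForm, coeff_sub, coeff_add, coeff_C_mul, coeff_X, coeff_C, coeff_X_pow]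
    interval_cases n <;> simp [toC, Complex.conj_ofNat] <;> ring

lemma reflect_pow_of_natDegree_le {p : ℂ[X]} {N : ℕ} (hp : p.natDegree ≤ N) (ℓ : ℕ) :
    reflect (N * ℓ) (p ^ ℓ) = reflect N p ^ ℓ := by
  induction ℓ with
  | zero => simp
  | succ ℓ ih =>
    rw [pow_succ, pow_succ, ← ih, mul_add, mul_one, reflect_mul _ _ _ hp]
    exact (natDegree_pow_le_of_le ℓ hp).trans_eq (mul_comm _ _)

lemma conj_harm {ℓ k : ℕ} (hk : k ≤ 2 * ℓ) (x : E3) :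
    conj (harm ℓ k (toC x)) = (-1) ^ (ℓ + k) * harm ℓ (2 * ℓ - k) (toC x) := by
  have h : (nullForm (toC x) ^ ℓ).map (starRingEnd ℂ) =
      C ((-1) ^ ℓ) * (reflect (2 * ℓ) (nullForm (toC x) ^ ℓ)).comp (C (-1) * X) := by
    rw [reflect_pow_of_natDegree_le (natDegree_nullForm_le _), Polynomial.map_pow,
      reflect_nullForm, neg_pow, Polynomial.pow_comp]
    simp
  have h2 := congrArg (fun p => p.coeff k) h
  simp only [coeff_map, coeff_C_mul, comp_C_mul_X_coeff, coeff_reflect, revAt_le hk] at h2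
  rw [harm, h2, harm]
  ring

/-- On the unit sphere, with `ρ = u₀ + i u₁`, the null form satisfies `ρ · nullForm = (ρ X + u₂)² -
1`. Its `ℓ`-th power is therefore the Taylor expansion at `u₂` of the polynomial in Rodrigues'
formula, with variable `ρ X`. -/
lemma harm_eq_legendre {ℓ m : ℕ} (u : E3) (hu : ‖u‖ = 1) :
    harm ℓ (ℓ + m) (toC u) = ((u 0 : ℂ) + Complex.I * (u 1 : ℂ)) ^ m *
      ((2 ^ ℓ * (ℓ ! : ℝ) / ((ℓ + m)! : ℝ) *
        (derivative^[m] (legendrePoly ℓ)).eval (u 2) : ℝ) : ℂ) := by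
  set ρ : ℂ := (u 0 : ℂ) + Complex.I * (u 1 : ℂ) with hρ
  set d : ℝ := (taylor (u 2) ((X ^ 2 - 1) ^ ℓ)).coeff (ℓ + m) with hd
  have hleg : 2 ^ ℓ * (ℓ ! : ℝ) / ((ℓ + m)! : ℝ) *
        (derivative^[m] (legendrePoly ℓ)).eval (u 2) = d := by
    have h1 : ((ℓ + m)! : ℝ) * d = (derivative^[ℓ + m] ((X ^ 2 - 1) ^ ℓ : ℝ[X])).eval (u 2) := by
      rw [hd, taylor_coeff, ← factorial_smul_hasseDeriv]
      simp
    have h2 : ((ℓ + m)! : ℝ) ≠ 0 := by positivity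
    have h3 : (ℓ ! : ℝ) ≠ 0 := by positivity
    rw [legendrePoly, iterate_derivative_C_mul, ← Function.iterate_add_apply, eval_C_mul,
      add_comm m ℓ, ← h1]
    field_simp
  rw [hleg]
  have hnorm : (u 0 : ℂ) ^ 2 + (u 1 : ℂ) ^ 2 + (u 2 : ℂ) ^ 2 = 1 := by
    have h := EuclideanSpace.norm_sq_eq u
    rw [hu, Fin.sum_univ_three] at h
    simp only [Real.norm_eq_abs, sq_abs, one_pow] at h
    exact_mod_cast h.symm
  have htay : (taylor (u 2) ((X ^ 2 - 1) ^ ℓ)).map Complex.ofRealHom =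
      ((X + C (u 2 : ℂ)) ^ 2 - 1) ^ ℓ := by
    simp [taylor_apply]
  have hd' : (d : ℂ) = (((X + C (u 2 : ℂ)) ^ 2 - 1) ^ ℓ).coeff (ℓ + m) := by
    rw [← htay, coeff_map, hd]
    rfl
  -- At the poles `ρ = 0` cannot be cancelled, but there the null form is just `2 u₂ X` with `u₂² =
  -- 1`.
  rcases eq_or_ne ρ 0 with h0 | h0
  · have h01 : (u 0 : ℂ) - Complex.I * (u 1 : ℂ) = 0 := by
      have := congrArg (starRingEnd ℂ) h0
      simpa [hρ, sub_eq_add_neg] using this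
    have hform : nullForm (toC u) = C (2 * (u 2 : ℂ)) * X := by
      have h0' : toC u 0 + Complex.I * toC u 1 = 0 := h0
      have h1' : toC u 0 - Complex.I * toC u 1 = 0 := h01
      rw [nullForm, h0', h1']
      simp [toC]
    have hsq : (u 2 : ℂ) ^ 2 = 1 := by
      rw [← hnorm]
      linear_combination (-((u 0 : ℂ) - Complex.I * (u 1 : ℂ))) * h0 -
        (u 1 : ℂ) ^ 2 * Complex.I_sq
    rw [harm, hform, mul_pow, ← C_pow, coeff_C_mul, coeff_X_pow, h0]
    rcases Nat.eq_zero_or_pos m with rfl | hm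
    · have h2 : ((X + C (u 2 : ℂ)) ^ 2 - 1 : ℂ[X]) ^ ℓ =
          (X + C (2 * (u 2 : ℂ))) ^ ℓ * X ^ ℓ := by
        rw [← mul_pow]
        congr 1
        have : C (u 2 : ℂ) ^ 2 = 1 := by rw [← C_pow, hsq, C_1]
        rw [C_mul, C_ofNat]
        linear_combination this
      rw [hd', h2, add_zero]
      have := coeff_mul_X_pow ((X + C (2 * (u 2 : ℂ))) ^ ℓ) ℓ 0
      rw [zero_add] at this
      rw [this, coeff_zero_eq_eval_zero]
      simp
    · rw [if_neg (by omega), zero_pow (by omega)]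
      simp
  · have h2 : C (ρ ^ ℓ) * nullForm (toC u) ^ ℓ =
        (((X + C (u 2 : ℂ)) ^ 2 - 1) ^ ℓ).comp (C ρ * X) := by
      rw [C_pow, ← mul_pow, pow_comp]
      congr 1
      simp only [nullForm, sub_comp, pow_comp, add_comp, X_comp, C_comp, one_comp]
      have h3 : C ρ * C (toC u 0 - Complex.I * toC u 1) = 1 - C (u 2 : ℂ) ^ 2 := by
        rw [← C_mul, ← C_pow, ← C_1, ← C_sub]
        congr 1
        rw [hρ]
        simp only [toC]
        linear_combination hnorm - (u 1 : ℂ) ^ 2 * Complex.I_sq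
      have h4 : C (toC u 0 + Complex.I * toC u 1) = C ρ := rfl
      rw [h4, C_mul, C_ofNat]
      simp only [toC]
      simp only [toC] at h3
      linear_combination -h3
    have h5 := congrArg (fun p => p.coeff (ℓ + m)) h2
    simp only [coeff_C_mul, comp_C_mul_X_coeff] at h5
    rw [← hd'] at h5
    apply mul_left_cancel₀ (pow_ne_zero ℓ h0)
    rw [harm, h5]
    ring

/-- The normalization constant of spherical harmonics. -/
def harmNorm (ℓ k : ℕ) : ℝ :=
  √((2 * (ℓ : ℝ) + 1) / (4 * π) * (((2 * ℓ - k)! : ℝ) * (k ! : ℝ))) / (2 ^ ℓ * (ℓ ! : ℝ))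

lemma sphHarmonicNonneg_eq {ℓ m : ℕ} (hm : m ≤ ℓ) (u : E3) (hu : ‖u‖ = 1) :
    sphHarmonicNonneg ℓ m u = (-1) ^ m * (harmNorm ℓ (ℓ + m) : ℂ) * harm ℓ (ℓ + m) (toC u) := by
  have h1 : √((2 * (ℓ : ℝ) + 1) / (4 * π) * (((ℓ - m)! : ℝ) / ((ℓ + m)! : ℝ))) =
      harmNorm ℓ (ℓ + m) * (2 ^ ℓ * (ℓ ! : ℝ) / ((ℓ + m)! : ℝ)) := by
    have h2 : (0 : ℝ) < ((ℓ + m)! : ℝ) := by positivity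
    have h3 : (0 : ℝ) < (ℓ ! : ℝ) := by positivity
    have h4 : (2 * (ℓ : ℝ) + 1) / (4 * π) * (((ℓ - m)! : ℝ) / ((ℓ + m)! : ℝ)) =
        (2 * (ℓ : ℝ) + 1) / (4 * π) * (((2 * ℓ - (ℓ + m))! : ℝ) * ((ℓ + m)! : ℝ)) /
          ((ℓ + m)! : ℝ) ^ 2 := by
      rw [show 2 * ℓ - (ℓ + m) = ℓ - m by omega]
      field_simp
    rw [h4, Real.sqrt_div' _ (by positivity), Real.sqrt_sq h2.le, harmNorm]
    field_simp
  rw [harm_eq_legendre u hu, sphHarmonicNonneg, h1]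
  push_cast
  ring

/-- The solid harmonic `|x| ^ ℓ Y_{ℓ m}(x / |x|)`. -/
def solidHarmonic (ℓ : ℕ) (m : ℤ) (x : E3) : ℂ :=
  (-1) ^ m.natAbs * (harmNorm ℓ (ℓ + m).toNat : ℂ) * harm ℓ (ℓ + m).toNat (toC x)

/-- Negative orders fit the same formula because conjugation exchanges the coefficients `k` and `2 ℓ
- k`, under which `harmNorm` is symmetric. -/
lemma sphHarmonic_eq_solidHarmonic {ℓ : ℕ} {m : ℤ} (hm : m ∈ Set.Icc (-(ℓ : ℤ)) ℓ) (u : E3)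
    (hu : ‖u‖ = 1) : sphHarmonic ℓ m u = solidHarmonic ℓ m u := by
  obtain ⟨hm1, hm2⟩ := hm
  rw [sphHarmonic, solidHarmonic]
  have hle : m.natAbs ≤ ℓ := by omega
  split_ifs with h0
  · rw [sphHarmonicNonneg_eq hle u hu, show (ℓ + m).toNat = ℓ + m.natAbs by omega]
  · rw [sphHarmonicNonneg_eq hle u hu, map_mul, map_mul, conj_harm (by omega),
      show (ℓ + m).toNat = ℓ - m.natAbs by omega, Complex.conj_ofReal, map_pow, map_neg, map_one,
      show 2 * ℓ - (ℓ + m.natAbs) = ℓ - m.natAbs by omega]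
    have hn : harmNorm ℓ (ℓ + m.natAbs) = harmNorm ℓ (ℓ - m.natAbs) := by
      rw [harmNorm, harmNorm, show 2 * ℓ - (ℓ + m.natAbs) = ℓ - m.natAbs by omega,
        show 2 * ℓ - (ℓ - m.natAbs) = ℓ + m.natAbs by omega, mul_comm (((ℓ - m.natAbs)! : ℕ) : ℝ)]
    rw [hn]
    have hs : ((-1 : ℂ) ^ m.natAbs) * (-1) ^ m.natAbs = 1 := by
      rw [← mul_pow]
      simp
    have hs' : ((-1 : ℂ) ^ ℓ) * (-1) ^ ℓ = 1 := by
      rw [← mul_pow]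
      simp
    rw [pow_add, pow_add]
    linear_combination ((-1 : ℂ) ^ m.natAbs * harmNorm ℓ (ℓ - m.natAbs) *
      harm ℓ (ℓ - m.natAbs) (toC u)) * ((-1) ^ ℓ * (-1) ^ ℓ * hs + hs')

lemma solidHarmonic_smul (ℓ : ℕ) (m : ℤ) (r : ℝ) (x : E3) :
    solidHarmonic ℓ m (r • x) = (r : ℂ) ^ ℓ * solidHarmonic ℓ m x := by
  rw [solidHarmonic, toC_smul, harm_smul, solidHarmonic]
  ring

lemma continuous_solidHarmonic (ℓ : ℕ) (m : ℤ) : Continuous (solidHarmonic ℓ m) := by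
  have := (continuous_harm ℓ (ℓ + m).toNat).comp continuous_toC
  exact continuous_const.mul this

lemma sphHarmonic_zero (u : E3) : sphHarmonic 0 0 u = solidHarmonic 0 0 u := by
  simp [sphHarmonic, sphHarmonicNonneg, solidHarmonic, harm, harmNorm, legendrePoly]

lemma norm_pow_mul_sphHarmonic {ℓ : ℕ} {m : ℤ} (hm : m ∈ Set.Icc (-(ℓ : ℤ)) ℓ) (x : E3) :
    (‖x‖ : ℂ) ^ ℓ * sphHarmonic ℓ m (dir x) = solidHarmonic ℓ m x := by
  -- At the origin `dir 0 = 0`, which is not a unit vector: for `ℓ = 0` the harmonic is constant,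
  -- and for `ℓ > 0` both sides vanish.
  rcases eq_or_ne x 0 with rfl | hx
  · rcases Nat.eq_zero_or_pos ℓ with rfl | hℓ
    · obtain rfl : m = 0 := by
        have := hm.1
        have := hm.2
        simp at *
        omega
      rw [sphHarmonic_zero]
      simp [dir]
    · have := solidHarmonic_smul ℓ m 0 0
      rw [zero_smul, Complex.ofReal_zero, zero_pow hℓ.ne', zero_mul] at this
      rw [this]
      simp [hℓ.ne']
  · rw [sphHarmonic_eq_solidHarmonic hm _ (norm_dir hx), ← solidHarmonic_smul, norm_smul_dir]

/-! ### Orthogonality and the Funk–Hecke formula -/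

lemma cdot_eq_sum (z : Fin 3 → ℂ) (x : E3) : cdot z x = ∑ i, z i * toC x i := rfl

lemma continuous_harm_toC (ℓ k : ℕ) : Continuous fun x : E3 => harm ℓ k (toC x) :=
  (continuous_harm ℓ k).comp continuous_toC

lemma sphereIntegral_null_pow_mul (ℓ : ℕ) (h : E3 → ℂ) (hh : Continuous h) (t : ℂ) :
    sphereIntegral (fun u => cdot (nullVec t) u ^ ℓ * h u) =
      ∑ k ∈ Finset.range (2 * ℓ + 1),
        sphereIntegral (fun u => harm ℓ k (toC u) * h u) * t ^ k := by
  calc _ = sphereIntegral (fun u => ∑ k ∈ Finset.range (2 * ℓ + 1),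
        t ^ k * (harm ℓ k (toC u) * h u)) := by
        congr 1
        funext u
        rw [cdot_eq_sum, ← sum_harm_mul_pow, Finset.sum_mul]
        exact Finset.sum_congr rfl fun k _ => by ring
    _ = _ := by
        rw [sphereIntegral_sum]
        · refine Finset.sum_congr rfl fun k _ => ?_
          rw [sphereIntegral_const_mul, mul_comm]
        · intro k _
          have := continuous_harm_toC ℓ k
          fun_prop

/-- Funk–Hecke for a monomial: the coefficient of `t ^ k` in the mixed moment formula with the null
vector `nullVec t`. -/
lemma sphereIntegral_harm_mul_pow (ℓ k s : ℕ) (w : Fin 3 → ℂ) :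
    sphereIntegral (fun u => harm ℓ k (toC u) * cdot w u ^ (ℓ + 2 * s)) =
      4 * π * ((ℓ + 2 * s)! : ℂ) * (besselCoeff ℓ s : ℂ) * harm ℓ k w * (∑ i, w i ^ 2) ^ s := by
  rcases lt_or_ge (2 * ℓ) k with hk | hk
  · simp [harm_eq_zero hk, sphereIntegral]
  have hcw := continuous_cdot w
  have key := coeff_eq_of_forall_sum_eq (A := 2 * ℓ + 1) (B := 2 * ℓ + 1)
    (a := fun k => sphereIntegral (fun u => harm ℓ k (toC u) * cdot w u ^ (ℓ + 2 * s)))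
    (b := fun k => 4 * π * ((ℓ + 2 * s)! : ℂ) * (besselCoeff ℓ s : ℂ) * harm ℓ k w *
      (∑ i, w i ^ 2) ^ s) (fun t => by
      rw [← sphereIntegral_null_pow_mul ℓ _ (by fun_prop),
        sphereIntegral_null_pow_mul_pow _ _ (sum_nullVec_sq t), ← sum_harm_mul_pow,
        Finset.mul_sum, Finset.sum_mul]
      exact Finset.sum_congr rfl fun k _ => by ring) k
  simpa only [if_pos (show k < 2 * ℓ + 1 by omega)] using key

lemma sphereIntegral_harm_mul_pow_eq_zero (ℓ k j : ℕ) (hj : ∀ s, j ≠ ℓ + 2 * s)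
    (w : Fin 3 → ℂ) :
    sphereIntegral (fun u => harm ℓ k (toC u) * cdot w u ^ j) = 0 := by
  rcases lt_or_ge (2 * ℓ) k with hk | hk
  · simp [harm_eq_zero hk, sphereIntegral]
  have hcw := continuous_cdot w
  have key := coeff_eq_of_forall_sum_eq (A := 2 * ℓ + 1) (B := 0)
    (a := fun k => sphereIntegral (fun u => harm ℓ k (toC u) * cdot w u ^ j))
    (b := fun k => 0) (fun t => by
      rw [← sphereIntegral_null_pow_mul ℓ _ (by fun_prop),
        sphereIntegral_null_pow_mul_pow_eq_zero _ _ (sum_nullVec_sq t) _ _ hj]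
      simp) k
  simpa only [if_pos (show k < 2 * ℓ + 1 by omega), not_lt_zero, if_false] using key

/-- The null form of `nullVec t` has a double root: it is `-2 (X - t)²`. -/
lemma harm_nullVec (ℓ k : ℕ) (t : ℂ) :
    harm ℓ k (nullVec t) = (-2) ^ ℓ * ((-t) ^ (2 * ℓ - k) * ((2 * ℓ).choose k : ℂ)) := by
  have : nullForm (nullVec t) = C (-2) * (X + C (-t)) ^ 2 := by
    have h1 : nullVec t 0 + Complex.I * nullVec t 1 = -2 := by
      simp only [nullVec, Matrix.cons_val]
      linear_combination (t ^ 2 + 1) * Complex.I_sq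
    have h2 : nullVec t 0 - Complex.I * nullVec t 1 = 2 * t ^ 2 := by
      simp only [nullVec, Matrix.cons_val]
      linear_combination -(t ^ 2 + 1) * Complex.I_sq
    have h3 : 2 * nullVec t 2 = 4 * t := by
      simp only [nullVec, Matrix.cons_val]
      ring
    rw [nullForm, h1, h2, h3]
    simp only [C_neg, C_mul, C_ofNat, C_pow]
    ring
  rw [harm, this, mul_pow, ← C_pow, coeff_C_mul, ← pow_mul, coeff_X_add_C_pow]

/-- Taking `w = nullVec t` in the Funk–Hecke formula, the integrals for all `k'` become the
coefficients of an explicit polynomial in `t`. -/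
lemma sphereIntegral_harm_mul_harm (ℓ k ℓ' k' : ℕ) :
    sphereIntegral (fun u => harm ℓ k (toC u) * harm ℓ' k' (toC u)) =
      if ℓ = ℓ' ∧ k + k' = 2 * ℓ then
        4 * π * (ℓ ! : ℂ) * (besselCoeff ℓ 0 : ℂ) * 2 ^ ℓ * (-1) ^ (ℓ + k) *
          ((2 * ℓ).choose k : ℂ) else 0 := by
  rcases lt_or_ge (2 * ℓ') k' with hk' | hk'
  · rw [if_neg (by omega)]
    simp [harm_eq_zero hk', sphereIntegral]
  have hch := continuous_harm_toC ℓ k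
  have hsum : ∀ t : ℂ, ∑ k' ∈ Finset.range (2 * ℓ' + 1),
      sphereIntegral (fun u => harm ℓ k (toC u) * harm ℓ' k' (toC u)) * t ^ k' =
      sphereIntegral (fun u => harm ℓ k (toC u) * cdot (nullVec t) u ^ ℓ') := by
    intro t
    simp_rw [mul_comm (harm ℓ k _)]
    exact (sphereIntegral_null_pow_mul ℓ' _ hch t).symm
  by_cases hℓ : ℓ = ℓ'
  · subst hℓ
    rcases lt_or_ge (2 * ℓ) k with hk | hk
    · rw [if_neg (by omega)]
      simp [harm_eq_zero hk, sphereIntegral]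
    have key := coeff_eq_of_forall_sum_eq (A := 2 * ℓ + 1) (B := 2 * ℓ + 1)
      (a := fun k' => sphereIntegral (fun u => harm ℓ k (toC u) * harm ℓ k' (toC u)))
      (b := fun k' => if k' = 2 * ℓ - k then
        4 * π * (ℓ ! : ℂ) * (besselCoeff ℓ 0 : ℂ) * 2 ^ ℓ * (-1) ^ (ℓ + k) *
          ((2 * ℓ).choose k : ℂ) else 0) (fun t => by
        have h := sphereIntegral_harm_mul_pow ℓ k 0 (nullVec t)
        rw [mul_zero, add_zero, harm_nullVec] at h
        rw [hsum, h]
        simp only [ite_mul, zero_mul, Finset.sum_ite_eq', Finset.mem_range]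
        rw [if_pos (by omega), neg_pow t, neg_pow (2 : ℂ) ℓ]
        have : ((-1 : ℂ)) ^ (2 * ℓ - k) = (-1) ^ k := by
          obtain ⟨d, hd⟩ := Nat.exists_eq_add_of_le hk
          rw [show 2 * ℓ - k = d by omega]
          have h1 : ((-1 : ℂ)) ^ (k + d) = 1 := by rw [← hd]; simp
          have h2 : ((-1 : ℂ)) ^ k * (-1) ^ k = 1 := by rw [← mul_pow]; simp
          rw [pow_add] at h1
          linear_combination (-1 : ℂ) ^ k * h1 - (-1 : ℂ) ^ d * h2
        rw [this]
        ring) k'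
    simp only [if_pos (show k' < 2 * ℓ + 1 by omega)] at key
    rw [key]
    refine if_congr ?_ rfl rfl
    omega
  · rw [if_neg (by tauto)]
    have key := coeff_eq_of_forall_sum_eq (A := 2 * ℓ' + 1) (B := 0)
      (a := fun k' => sphereIntegral (fun u => harm ℓ k (toC u) * harm ℓ' k' (toC u)))
      (b := fun k' => 0) (fun t => by
        rw [hsum]
        by_cases hs : ∃ s, ℓ' = ℓ + 2 * s
        · obtain ⟨s, rfl⟩ := hs
          -- Here `s ≠ 0` because `ℓ ≠ ℓ'`, so a positive power of `nullVec t · nullVec t = 0`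
          -- appears.
          rw [sphereIntegral_harm_mul_pow, sum_nullVec_sq, zero_pow (by omega)]
          simp
        · rw [sphereIntegral_harm_mul_pow_eq_zero]
          · simp
          · simpa using hs) k'
    simpa only [if_pos (show k' < 2 * ℓ' + 1 by omega), not_lt_zero, if_false] using key

lemma harmNorm_sq {ℓ k : ℕ} (hk : k ≤ 2 * ℓ) :
    harmNorm ℓ k ^ 2 * (4 * π * (ℓ ! : ℝ) * besselCoeff ℓ 0 * 2 ^ ℓ * ((2 * ℓ).choose k : ℝ)) =
      1 := by
  have hfac := Nat.factorial_eq_mul_doubleFactorial (2 * ℓ)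
  rw [Nat.doubleFactorial_two_mul, Nat.factorial_succ] at hfac
  have hfac' : (2 * (ℓ : ℝ) + 1) * ((2 * ℓ)! : ℝ) =
    ((2 * ℓ + 1)‼ : ℝ) * (2 ^ ℓ * (ℓ ! : ℝ)) := by exact_mod_cast hfac
  have hch : ((2 * ℓ).choose k : ℝ) * (k ! : ℝ) * ((2 * ℓ - k)! : ℝ) = ((2 * ℓ)! : ℝ) := by
    exact_mod_cast Nat.choose_mul_factorial_mul_factorial hk
  have h1 : (0 : ℝ) < ((2 * ℓ + 1)‼ : ℝ) := by exact_mod_cast Nat.doubleFactorial_pos _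
  have h2 : (0 : ℝ) < (ℓ ! : ℝ) := by positivity
  rw [harmNorm, div_pow, Real.sq_sqrt (by positivity), besselCoeff]
  simp only [pow_zero, Nat.factorial_zero, Nat.cast_one, one_mul, add_zero]
  have := Real.pi_pos
  field_simp
  rw [← hch] at hfac'
  linear_combination hfac'

lemma sphereIntegral_sphHarmonic {ℓ ℓ' : ℕ} {m m' : ℤ} (hm : m ∈ Set.Icc (-(ℓ : ℤ)) ℓ)
    (hm' : m' ∈ Set.Icc (-(ℓ' : ℤ)) ℓ') :
    sphereIntegral (fun u => sphHarmonic ℓ m u * conj (sphHarmonic ℓ' m' u)) =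
      if ℓ = ℓ' ∧ m = m' then 1 else 0 := by
  have hk' : (ℓ' + m').toNat ≤ 2 * ℓ' := by
    obtain ⟨h1, h2⟩ := hm'
    omega
  calc _ = sphereIntegral (fun u =>
        ((-1) ^ m.natAbs * (harmNorm ℓ (ℓ + m).toNat : ℂ) * ((-1) ^ m'.natAbs *
          (harmNorm ℓ' (ℓ' + m').toNat : ℂ)) * (-1) ^ (ℓ' + (ℓ' + m').toNat)) *
          (harm ℓ (ℓ + m).toNat (toC u) * harm ℓ' (2 * ℓ' - (ℓ' + m').toNat) (toC u))) := by
        refine sphereIntegral_congr fun u hu => ?_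
        rw [sphHarmonic_eq_solidHarmonic hm u hu, sphHarmonic_eq_solidHarmonic hm' u hu,
          solidHarmonic, solidHarmonic, map_mul, map_mul, conj_harm hk', Complex.conj_ofReal,
          map_pow, map_neg, map_one]
        ring
    _ = _ := by
        rw [sphereIntegral_const_mul, sphereIntegral_harm_mul_harm]
        by_cases h : ℓ = ℓ' ∧ m = m'
        · obtain ⟨rfl, rfl⟩ := h
          have hc : ℓ = ℓ ∧ (ℓ + m).toNat + (2 * ℓ - (ℓ + m).toNat) = 2 * ℓ := ⟨rfl, by omega⟩
          rw [if_pos hc, if_pos ⟨rfl, rfl⟩]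
          have hN : ((harmNorm ℓ (ℓ + m).toNat : ℂ)) ^ 2 * (4 * π * (ℓ ! : ℂ) *
              (besselCoeff ℓ 0 : ℂ) * 2 ^ ℓ * ((2 * ℓ).choose (ℓ + m).toNat : ℂ)) = 1 := by
            exact_mod_cast harmNorm_sq hk'
          have h1 : ((-1 : ℂ) ^ m.natAbs) * (-1) ^ m.natAbs = 1 := by
            rw [← mul_pow]
            simp
          have h2 : ((-1 : ℂ) ^ (ℓ + (ℓ + m).toNat)) * (-1) ^ (ℓ + (ℓ + m).toNat) = 1 := by
            rw [← mul_pow]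
            simp
          refine Eq.trans ?_ hN
          linear_combination ((harmNorm ℓ (ℓ + m).toNat : ℂ)) ^ 2 * (4 * π * (ℓ ! : ℂ) *
              (besselCoeff ℓ 0 : ℂ) * 2 ^ ℓ * ((2 * ℓ).choose (ℓ + m).toNat : ℂ)) *
              ((-1 : ℂ) ^ (ℓ + (ℓ + m).toNat) * (-1) ^ (ℓ + (ℓ + m).toNat) * h1 + h2)
        · rw [if_neg h, if_neg, mul_zero]
          rintro ⟨rfl, h2⟩
          refine h ⟨rfl, ?_⟩
          obtain ⟨h3, h4⟩ := hm
          obtain ⟨h5, h6⟩ := hm'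
          omega

/-! ### Integrals over the ball -/

lemma inner_eq_cdot (K x : E3) : ((⟪K, x⟫_ℝ : ℝ) : ℂ) = cdot (toC K) x := by
  rw [cdot, PiLp.inner_apply]
  push_cast
  refine Finset.sum_congr rfl fun i _ => ?_
  simp [toC, mul_comm]

lemma sum_toC_sq (K : E3) : ∑ i, toC K i ^ 2 = (‖K‖ : ℂ) ^ 2 := by
  rw [← Complex.ofReal_pow, EuclideanSpace.norm_sq_eq]
  simp [toC]

lemma setIntegral_harm_mul_cdot_pow {R : ℝ} (hR : 0 ≤ R) (n ℓ k j : ℕ) (K : E3) :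
    ∫ x in Metric.closedBall (0 : E3) R,
        ((‖x‖ : ℂ) ^ 2 - (R : ℂ) ^ 2) ^ n * (harm ℓ k (toC x) * cdot (toC K) x ^ j) =
      sphereIntegral (fun u => harm ℓ k (toC u) * cdot (toC K) u ^ j) *
        ((∫ r in (0 : ℝ)..R, r ^ (ℓ + j + 2) * (r ^ 2 - R ^ 2) ^ n : ℝ) : ℂ) := by
  have h := setIntegral_closedBall_radial_mul_homogeneous hR
    (fun r => ((r : ℂ) ^ 2 - (R : ℂ) ^ 2) ^ n)
    (fun x => harm ℓ k (toC x) * cdot (toC K) x ^ j) (ℓ + j)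
    (fun r x => by rw [toC_smul, harm_smul, cdot_smul]; ring)
  rw [h, ← intervalIntegral.integral_ofReal]
  congr 2
  funext r
  push_cast
  rfl

lemma hasSum_setIntegral_harm_mul_exp (R : ℝ) (n ℓ k : ℕ) (K : E3) :
    HasSum (fun j : ℕ => (-Complex.I) ^ j / (j ! : ℂ) *
      ∫ x in Metric.closedBall (0 : E3) R,
        ((‖x‖ : ℂ) ^ 2 - (R : ℂ) ^ 2) ^ n * (harm ℓ k (toC x) * cdot (toC K) x ^ j))
      (∫ x in Metric.closedBall (0 : E3) R,
        ((‖x‖ : ℂ) ^ 2 - (R : ℂ) ^ 2) ^ n * harm ℓ k (toC x) *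
          Complex.exp (-(Complex.I * (⟪K, x⟫_ℝ : ℂ)))) := by
  set g : E3 → ℂ := fun x => ((‖x‖ : ℂ) ^ 2 - (R : ℂ) ^ 2) ^ n * harm ℓ k (toC x) with hg
  have hch := continuous_harm_toC ℓ k
  have hgc : Continuous g := by fun_prop
  have hcK := continuous_cdot (toC K)
  have hbound : ∀ x : E3, HasSum (fun j : ℕ => ‖g x‖ * (‖cdot (toC K) x‖ ^ j / (j ! : ℝ)))
      (‖g x‖ * rexp ‖cdot (toC K) x‖) := by
    intro x
    rw [Real.exp_eq_exp_ℝ]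
    exact (NormedSpace.expSeries_div_hasSum_exp (𝔸 := ℝ) _).mul_left _
  have h := hasSum_integral_of_dominated_convergence
    (μ := (volume : Measure E3).restrict (Metric.closedBall 0 R))
    (F := fun (j : ℕ) x => g x * ((-(Complex.I * (⟪K, x⟫_ℝ : ℂ))) ^ j / (j ! : ℂ)))
    (f := fun x => g x * Complex.exp (-(Complex.I * (⟪K, x⟫_ℝ : ℂ))))
    (fun j x => ‖g x‖ * (‖cdot (toC K) x‖ ^ j / (j ! : ℝ)))
    (fun j => by
      simp_rw [inner_eq_cdot]
      apply Continuous.aestronglyMeasurable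
      fun_prop)
    (fun j => Filter.Eventually.of_forall fun x => by
      rw [norm_mul, norm_div, norm_pow, norm_neg, norm_mul Complex.I, Complex.norm_I, one_mul,
        Complex.norm_natCast, inner_eq_cdot])
    (Filter.Eventually.of_forall fun x => (hbound x).summable)
    (by
      simp_rw [fun x => (hbound x).tsum_eq]
      refine ContinuousOn.integrableOn_compact (isCompact_closedBall _ _) ?_
      apply Continuous.continuousOn
      fun_prop)
    (Filter.Eventually.of_forall fun x => by
      rw [Complex.exp_eq_exp_ℂ]
      exact (NormedSpace.expSeries_div_hasSum_exp (𝔸 := ℂ) _).mul_left _)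
  convert! h using 2 with j
  rw [← integral_const_mul]
  congr 1 with x
  rw [inner_eq_cdot, hg, ← neg_mul, mul_pow]
  ring

lemma setIntegral_harm_mul_exp {R : ℝ} (hR : 0 ≤ R) (n ℓ k : ℕ) {K : E3} (hK : K ≠ 0) :
    ∫ x in Metric.closedBall (0 : E3) R,
        ((‖x‖ : ℂ) ^ 2 - (R : ℂ) ^ 2) ^ n * harm ℓ k (toC x) *
          Complex.exp (-(Complex.I * (⟪K, x⟫_ℝ : ℂ))) =
      4 * π * (-Complex.I) ^ ℓ * ((-2) ^ n * (n ! : ℂ) * (R : ℂ) ^ (ℓ + n + 2)) *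
        ((sphBesselJ (ℓ + n + 1) (‖K‖ * R) : ℂ) / (‖K‖ : ℂ) ^ (n + 1)) *
          harm ℓ k (toC (dir K)) := by
  have hκ : ‖K‖ ≠ 0 := norm_ne_zero_iff.2 hK
  have hκ' : (‖K‖ : ℂ) ≠ 0 := by exact_mod_cast hκ
  have h := hasSum_setIntegral_harm_mul_exp R n ℓ k K
  simp_rw [setIntegral_harm_mul_cdot_pow hR] at h
  refine h.unique ?_
  -- Only the powers `j = ℓ + 2 s` contribute; there `(-i) ^ j = (-i) ^ ℓ (-1) ^ s` supplies the
  -- alternating sign of `j_ν`.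
  have hinj : Function.Injective (fun s : ℕ => ℓ + 2 * s) := fun p q h => by simpa using h
  rw [← hinj.hasSum_iff]
  · have hJ : HasSum (fun s => (((-1) ^ s * besselCoeff (ℓ + n + 1) s *
        (‖K‖ * R) ^ (ℓ + n + 1 + 2 * s) : ℝ) : ℂ))
        (sphBesselJ (ℓ + n + 1) (‖K‖ * R) : ℂ) := by
      rw [sphBesselJ_eq_tsum]
      refine Complex.hasSum_ofReal.2 (Summable.hasSum ?_)
      refine Summable.of_norm_bounded (summable_besselCoeff (ℓ + n + 1) (|‖K‖ * R|)) fun s => ?_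
      rw [norm_mul, norm_mul, norm_pow, norm_neg, norm_one, one_pow, one_mul, norm_pow,
        Real.norm_of_nonneg (besselCoeff_pos _ s).le, Real.norm_eq_abs]
    have hJ' := hJ.mul_left (4 * π * (-Complex.I) ^ ℓ *
      ((-2) ^ n * (n ! : ℂ) * (R : ℂ) ^ (ℓ + n + 2)) / (‖K‖ : ℂ) ^ (n + 1) *
        harm ℓ k (toC (dir K)))
    convert! hJ' using 1
    · funext s
      have hb := congrArg (fun y : ℝ => (y : ℂ)) (besselCoeff_mul_integral R ‖K‖ hκ ℓ n s)
      simp only [Function.comp_apply]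
      rw [sphereIntegral_harm_mul_pow, sum_toC_sq,
        show ℓ + (ℓ + 2 * s) + 2 = 2 * (ℓ + s + 1) by ring]
      have hKd : harm ℓ k (toC K) = (‖K‖ : ℂ) ^ ℓ * harm ℓ k (toC (dir K)) := by
        rw [← harm_smul, ← toC_smul, norm_smul_dir]
      have hI : (-Complex.I) ^ (ℓ + 2 * s) = (-Complex.I) ^ ℓ * (-1) ^ s := by
        rw [pow_add, pow_mul, neg_sq, Complex.I_sq]
      have hf : ((ℓ + 2 * s)! : ℂ) ≠ 0 := by exact_mod_cast (Nat.factorial_pos _).ne'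
      rw [hKd, hI]
      push_cast at hb ⊢
      set b : ℂ := ((∫ r in (0 : ℝ)..R, r ^ (2 * (ℓ + s + 1)) * (r ^ 2 - R ^ 2) ^ n : ℝ) : ℂ)
      calc _ = 4 * π * (-Complex.I) ^ ℓ * (-1) ^ s * harm ℓ k (toC (dir K)) *
            ((besselCoeff ℓ s : ℂ) * (‖K‖ : ℂ) ^ (ℓ + 2 * s) * b) *
            (((ℓ + 2 * s)! : ℂ) / ((ℓ + 2 * s)! : ℂ)) := by ring
        _ = _ := by
            rw [hb, div_self hf]
            ring
    · ring
  · intro j hj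
    rw [sphereIntegral_harm_mul_pow_eq_zero]
    · simp
    · intro s hs
      exact hj ⟨s, hs.symm⟩

lemma setIntegral_solidHarmonic_mul_exp {R : ℝ} (hR : 0 ≤ R) (n : ℕ) {ℓ : ℕ} {m : ℤ}
    (hm : m ∈ Set.Icc (-(ℓ : ℤ)) ℓ) {K : E3} (hK : K ≠ 0) :
    ∫ x in Metric.closedBall (0 : E3) R,
        ((‖x‖ : ℂ) ^ 2 - (R : ℂ) ^ 2) ^ n * solidHarmonic ℓ m x *
          Complex.exp (-(Complex.I * (⟪K, x⟫_ℝ : ℂ))) =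
      4 * π * (-Complex.I) ^ ℓ * ((-2) ^ n * (n ! : ℂ) * (R : ℂ) ^ (ℓ + n + 2)) *
        ((sphBesselJ (ℓ + n + 1) (‖K‖ * R) : ℂ) / (‖K‖ : ℂ) ^ (n + 1)) *
          sphHarmonic ℓ m (dir K) := by
  rw [sphHarmonic_eq_solidHarmonic hm _ (norm_dir hK), solidHarmonic, mul_left_comm,
    ← setIntegral_harm_mul_exp hR n ℓ _ hK, ← integral_const_mul]
  congr 1 with x
  rw [solidHarmonic]
  ring

/-- The case `j = 0`, `K = 0` of the ball integrals: a harmonic of positive degree has mean zero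
over the sphere. -/
lemma setIntegral_solidHarmonic {R : ℝ} (hR : 0 ≤ R) (n ℓ : ℕ) (m : ℤ) :
    ∫ x in Metric.closedBall (0 : E3) R,
        ((‖x‖ : ℂ) ^ 2 - (R : ℂ) ^ 2) ^ n * solidHarmonic ℓ m x =
      if ℓ = 0 then 4 * π * solidHarmonic 0 m 0 *
        ((-2) ^ n * (n ! : ℂ) * (R : ℂ) ^ (2 * n + 3) / ((2 * n + 3)‼ : ℂ)) else 0 := by
  have h := setIntegral_harm_mul_cdot_pow hR n ℓ (ℓ + m).toNat 0 0
  simp only [pow_zero, mul_one, add_zero] at h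
  have h2 : ∫ x in Metric.closedBall (0 : E3) R,
        ((‖x‖ : ℂ) ^ 2 - (R : ℂ) ^ 2) ^ n * solidHarmonic ℓ m x =
      (-1) ^ m.natAbs * (harmNorm ℓ (ℓ + m).toNat : ℂ) *
        ∫ x in Metric.closedBall (0 : E3) R,
          ((‖x‖ : ℂ) ^ 2 - (R : ℂ) ^ 2) ^ n * harm ℓ (ℓ + m).toNat (toC x) := by
    rw [← integral_const_mul]
    congr 1 with x
    rw [solidHarmonic]
    ring
  rw [h2, h]
  split_ifs with h0
  · subst h0
    have h3 := sphereIntegral_harm_mul_pow 0 ((0 : ℕ) + m).toNat 0 (toC 0)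
    simp only [mul_zero, add_zero, pow_zero, mul_one] at h3
    have h4 := integral_pow_mul_sq_sub_sq_pow R n 0
    simp only [zero_add, mul_one, mul_zero] at h4
    rw [h3, zero_add, h4, solidHarmonic]
    simp [besselCoeff]
    ring
  · have h3 := sphereIntegral_harm_mul_pow_eq_zero ℓ (ℓ + m).toNat 0 (by omega) 0
    simp only [pow_zero, mul_one] at h3
    rw [h3]
    simp

lemma setIntegral_radial_mul_sphHarmonic {R : ℝ} (hR : 0 ≤ R) (F : ℝ → ℂ) {ℓ ℓ' : ℕ} {m m' : ℤ}
    (hm : m ∈ Set.Icc (-(ℓ : ℤ)) ℓ) (hm' : m' ∈ Set.Icc (-(ℓ' : ℤ)) ℓ') :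
    ∫ x in Metric.closedBall (0 : E3) R,
        F ‖x‖ * (sphHarmonic ℓ m (dir x) * conj (sphHarmonic ℓ' m' (dir x))) =
      if ℓ = ℓ' ∧ m = m' then ∫ r in (0 : ℝ)..R, (r : ℂ) ^ 2 * F r else 0 := by
  rw [setIntegral_closedBall_radial_mul_dir hR F
    (fun u => sphHarmonic ℓ m u * conj (sphHarmonic ℓ' m' u)), sphereIntegral_sphHarmonic hm hm']
  split_ifs <;> simp

/-! ### Fourier coefficients of periodized functions -/

lemma exp_inner_sub_lattice {b : Module.Basis (Fin 3) ℝ E3} {K : E3} (hK : K ∈ reciprocalLattice b)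
    (v : lattice b) (x : E3) :
    Complex.exp (-(Complex.I * (⟪K, x - v⟫_ℝ : ℂ))) =
      Complex.exp (-(Complex.I * (⟪K, x⟫_ℝ : ℂ))) := by
  obtain ⟨j, hj⟩ := hK v v.2
  rw [Complex.exp_eq_exp_iff_exists_int]
  refine ⟨j, ?_⟩
  rw [inner_sub_right, hj]
  push_cast
  ring

lemma norm_exp_neg_I_mul (r : ℝ) : ‖Complex.exp (-(Complex.I * (r : ℂ)))‖ = 1 := by
  rw [Complex.norm_exp]
  simp

lemma fourierCoefficient_periodize (b : Module.Basis (Fin 3) ℝ E3) {f : E3 → ℂ}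
    (hf : Integrable f) {K : E3} (hK : K ∈ reciprocalLattice b) :
    fourierCoefficient b (periodize b f) K = 1 / (cellVolume b : ℂ) *
      ∫ x, f x * Complex.exp (-(Complex.I * (⟪K, x⟫_ℝ : ℂ))) := by
  set G : E3 → ℂ := fun x => f x * Complex.exp (-(Complex.I * (⟪K, x⟫_ℝ : ℂ))) with hG
  have hGi : Integrable G := by
    refine hf.mul_bdd (c := 1) (by apply Continuous.aestronglyMeasurable; fun_prop)
      (Filter.Eventually.of_forall fun x => (norm_exp_neg_I_mul _).le)
  have : VAddInvariantMeasure (lattice b) E3 volume :=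
    ⟨fun c s _ => measure_preimage_add volume (c : E3) s⟩
  have hdom := ZSpan.isAddFundamentalDomain b (volume : Measure E3)
  have hper : ∀ x, periodize b f x * Complex.exp (-(Complex.I * (⟪K, x⟫_ℝ : ℂ))) =
      ∑' v : lattice b, G (-v +ᵥ x) := by
    intro x
    rw [periodize, ← tsum_mul_right]
    refine tsum_congr fun v => ?_
    have hv : -v +ᵥ x = x - (v : E3) := by
      rw [Submodule.vadd_def, vadd_eq_add, Submodule.coe_neg]
      abel
    rw [hv, hG]
    simp only [exp_inner_sub_lattice hK]
  rw [fourierCoefficient]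
  simp_rw [hper]
  congr 1
  rw [hdom.integral_eq_tsum' G hGi, integral_tsum]
  · intro v
    have h1 : Integrable (fun x => G (-v +ᵥ x)) :=
      (measurePreserving_vadd (-v) (volume : Measure E3)).integrable_comp_of_integrable hGi
    exact h1.aestronglyMeasurable.restrict
  -- Unfolding the norm in the same way shows that the sum of the cell integrals of the norms is the
  -- finite integral over all of space.
  · rw [← hdom.lintegral_eq_tsum' fun x => ‖G x‖ₑ]
    exact hGi.2.ne

/-! ### The pseudo-charge density in the ball -/

lemma sumL_congr {ℓmax : ℕ} {f g : ℕ → ℤ → ℂ}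
    (h : ∀ ℓ ≤ ℓmax, ∀ m ∈ Set.Icc (-(ℓ : ℤ)) (ℓ : ℤ), f ℓ m = g ℓ m) :
    sumL ℓmax f = sumL ℓmax g :=
  Finset.sum_congr rfl fun ℓ hℓ => Finset.sum_congr rfl fun m hm =>
    h ℓ (Nat.lt_succ_iff.1 (Finset.mem_range.1 hℓ)) m (by simpa using hm)

lemma mul_sumL (c : ℂ) (ℓmax : ℕ) (f : ℕ → ℤ → ℂ) :
    c * sumL ℓmax f = sumL ℓmax fun ℓ m => c * f ℓ m := by
  simp only [sumL, Finset.mul_sum]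

lemma sumL_ite_eq {ℓmax ℓ : ℕ} {m : ℤ} (hℓ : ℓ ≤ ℓmax) (hm : m ∈ Set.Icc (-(ℓ : ℤ)) (ℓ : ℤ))
    (f : ℕ → ℤ → ℂ) :
    (sumL ℓmax fun ℓ' m' => if ℓ' = ℓ ∧ m' = m then f ℓ' m' else 0) = f ℓ m := by
  rw [sumL, Finset.sum_eq_single_of_mem ℓ (Finset.mem_range.2 (by omega)),
    Finset.sum_eq_single_of_mem m (by simpa using hm)]
  · simp
  · intro m' _ h
    rw [if_neg (by tauto)]
  · intro ℓ' _ h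
    exact Finset.sum_eq_zero fun m' _ => if_neg (by tauto)

lemma pseudoRadial_eq (R : ℝ) (ℓ n : ℕ) (a Q : ℂ) (r : ℝ) :
    pseudoRadial R ℓ n a Q r = a * ((r : ℂ) ^ 2 - (R : ℂ) ^ 2) ^ n * Q * (r : ℂ) ^ ℓ := by
  rw [pseudoRadial, sub_eq_add_neg, add_pow, Finset.mul_sum, Finset.mul_sum, Finset.sum_mul,
    Finset.sum_mul]
  refine Finset.sum_congr rfl fun η _ => ?_
  rw [ansatzCoeff, neg_pow ((R : ℂ) ^ 2)]
  ring

lemma pseudoCharge_of_le (τ : E3) {R : ℝ} (ℓmax : ℕ) (n : ℕ → ℕ) (a : ℕ → ℂ) (Q : ℕ → ℤ → ℂ)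
    {x : E3} (hx : ‖x‖ ≤ R) :
    pseudoCharge τ R ℓmax n a Q (x + τ) =
      sumL ℓmax fun ℓ m =>
        a ℓ * ((‖x‖ : ℂ) ^ 2 - (R : ℂ) ^ 2) ^ (n ℓ) * Q ℓ m * (‖x‖ : ℂ) ^ ℓ *
          sphHarmonic ℓ m (dir x) := by
  rw [pseudoCharge, add_sub_cancel_right, if_pos hx]
  simp_rw [pseudoRadial_eq]

lemma pseudoCharge_eq_solidHarmonic (τ : E3) {R : ℝ} (ℓmax : ℕ) (n : ℕ → ℕ) (a : ℕ → ℂ)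
    (Q : ℕ → ℤ → ℂ) {x : E3} (hx : ‖x‖ ≤ R) :
    pseudoCharge τ R ℓmax n a Q (x + τ) =
      sumL ℓmax fun ℓ m =>
        a ℓ * Q ℓ m * (((‖x‖ : ℂ) ^ 2 - (R : ℂ) ^ 2) ^ (n ℓ) * solidHarmonic ℓ m x) := by
  rw [pseudoCharge_of_le τ ℓmax n a Q hx]
  refine sumL_congr fun ℓ _ m hm => ?_
  rw [← norm_pow_mul_sphHarmonic hm]
  ring

lemma pseudoCharge_of_lt (τ : E3) {R : ℝ} (ℓmax : ℕ) (n : ℕ → ℕ) (a : ℕ → ℂ) (Q : ℕ → ℤ → ℂ)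
    {x : E3} (hx : R < ‖x‖) : pseudoCharge τ R ℓmax n a Q (x + τ) = 0 := by
  rw [pseudoCharge, add_sub_cancel_right, if_neg hx.not_ge]

lemma pseudoCharge_add_eq_indicator (τ : E3) (R : ℝ) (ℓmax : ℕ) (n : ℕ → ℕ) (a : ℕ → ℂ)
    (Q : ℕ → ℤ → ℂ) :
    (fun x => pseudoCharge τ R ℓmax n a Q (x + τ)) =
      (Metric.closedBall (0 : E3) R).indicator fun x => sumL ℓmax fun ℓ m =>
        a ℓ * Q ℓ m * (((‖x‖ : ℂ) ^ 2 - (R : ℂ) ^ 2) ^ (n ℓ) * solidHarmonic ℓ m x) := by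
  funext x
  by_cases hx : ‖x‖ ≤ R
  · rw [Set.indicator_of_mem (by simpa using hx), pseudoCharge_eq_solidHarmonic τ ℓmax n a Q hx]
  · rw [Set.indicator_of_notMem (by simpa using hx),
      pseudoCharge_of_lt τ ℓmax n a Q (not_le.1 hx)]

lemma integrable_pseudoCharge (τ : E3) (R : ℝ) (ℓmax : ℕ) (n : ℕ → ℕ) (a : ℕ → ℂ)
    (Q : ℕ → ℤ → ℂ) : Integrable (pseudoCharge τ R ℓmax n a Q) := by
  have h : Integrable (fun x => pseudoCharge τ R ℓmax n a Q (x + τ)) := by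
    rw [pseudoCharge_add_eq_indicator, integrable_indicator_iff
      Metric.isClosed_closedBall.measurableSet]
    refine ContinuousOn.integrableOn_compact (isCompact_closedBall _ _)
      (Continuous.continuousOn ?_)
    unfold sumL
    refine continuous_finsetSum _ fun ℓ _ => continuous_finsetSum _ fun m _ => ?_
    have := continuous_solidHarmonic ℓ m
    fun_prop
  simpa using h.comp_sub_right τ

lemma integral_pseudoCharge_mul_exp (τ : E3) (R : ℝ) (ℓmax : ℕ) (n : ℕ → ℕ) (a : ℕ → ℂ)
    (Q : ℕ → ℤ → ℂ) (K : E3) :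
    ∫ x, pseudoCharge τ R ℓmax n a Q x * Complex.exp (-(Complex.I * (⟪K, x⟫_ℝ : ℂ))) =
      Complex.exp (-(Complex.I * (⟪K, τ⟫_ℝ : ℂ))) *
        ∫ x in Metric.closedBall (0 : E3) R, pseudoCharge τ R ℓmax n a Q (x + τ) *
          Complex.exp (-(Complex.I * (⟪K, x⟫_ℝ : ℂ))) := by
  rw [← integral_add_right_eq_self _ τ, ← integral_const_mul,
    ← integral_indicator Metric.isClosed_closedBall.measurableSet]
  congr 1 with x
  by_cases hx : ‖x‖ ≤ R
  · rw [Set.indicator_of_mem (by simpa using hx), inner_add_right, Complex.ofReal_add, mul_add,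
      neg_add, Complex.exp_add]
    ring
  · rw [Set.indicator_of_notMem (by simpa using hx),
      pseudoCharge_of_lt τ ℓmax n a Q (not_le.1 hx), zero_mul]

lemma setIntegral_pseudoCharge_mul (τ : E3) (R : ℝ) (ℓmax : ℕ) (n : ℕ → ℕ) (a : ℕ → ℂ)
    (Q : ℕ → ℤ → ℂ) {g : E3 → ℂ} (hg : IntegrableOn g (Metric.closedBall (0 : E3) R)) :
    ∫ x in Metric.closedBall (0 : E3) R, pseudoCharge τ R ℓmax n a Q (x + τ) * g x =
      sumL ℓmax fun ℓ m => a ℓ * Q ℓ m * ∫ x in Metric.closedBall (0 : E3) R,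
        ((‖x‖ : ℂ) ^ 2 - (R : ℂ) ^ 2) ^ (n ℓ) * solidHarmonic ℓ m x * g x := by
  have hi : ∀ ℓ m, IntegrableOn (fun x => a ℓ * Q ℓ m *
      (((‖x‖ : ℂ) ^ 2 - (R : ℂ) ^ 2) ^ (n ℓ) * solidHarmonic ℓ m x * g x))
      (Metric.closedBall (0 : E3) R) := by
    intro ℓ m
    have := continuous_solidHarmonic ℓ m
    exact (hg.continuousOn_mul (Continuous.continuousOn (by fun_prop))
      (isCompact_closedBall _ _)).const_mul _
  calc _ = ∫ x in Metric.closedBall (0 : E3) R, sumL ℓmax fun ℓ m => a ℓ * Q ℓ m *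
        (((‖x‖ : ℂ) ^ 2 - (R : ℂ) ^ 2) ^ (n ℓ) * solidHarmonic ℓ m x * g x) := by
        refine setIntegral_congr_fun Metric.isClosed_closedBall.measurableSet fun x hx => ?_
        rw [pseudoCharge_eq_solidHarmonic τ ℓmax n a Q (by simpa using hx), mul_comm, mul_sumL]
        exact sumL_congr fun ℓ _ m _ => by ring
    _ = _ := by
        unfold sumL
        rw [integral_finsetSum _ fun ℓ _ => integrable_finsetSum _ fun m _ => hi ℓ m]
        refine Finset.sum_congr rfl fun ℓ _ => ?_
        rw [integral_finsetSum _ fun m _ => hi ℓ m]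
        exact Finset.sum_congr rfl fun m _ => integral_const_mul _ _

/-! ### Moments of the pseudo-charge density -/

lemma continuous_sphHarmonic (ℓ : ℕ) (m : ℤ) : Continuous (sphHarmonic ℓ m) := by
  have h : ∀ k, Continuous (sphHarmonicNonneg ℓ k) := by
    intro k
    have hp : Continuous fun u : E3 => (derivative^[k] (legendrePoly ℓ)).eval (u 2) :=
      (derivative^[k] (legendrePoly ℓ)).continuous.comp (by fun_prop)
    unfold sphHarmonicNonneg
    fun_prop
  unfold sphHarmonic
  split_ifs
  · exact h _
  · exact continuous_const.mul (Complex.continuous_conj.comp (h _))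

/-- The integrand may be discontinuous at the origin, so boundedness and measurability replace
continuity. The bound is taken on the closed unit ball, which also contains `dir 0 = 0`. -/
lemma integrableOn_sphHarmonic_dir (ℓ : ℕ) (m : ℤ) (R : ℝ) :
    IntegrableOn (fun x => conj (sphHarmonic ℓ m (dir x))) (Metric.closedBall (0 : E3) R) := by
  obtain ⟨C, hC⟩ := (isCompact_closedBall (0 : E3) 1).exists_bound_of_continuousOn
    (continuous_sphHarmonic ℓ m).continuousOn
  have hdir : Measurable dir := by
    unfold dir
    fun_prop
  refine Measure.integrableOn_of_bounded (M := C) (isCompact_closedBall _ _).measure_lt_top.ne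
    ?_ (Filter.Eventually.of_forall fun x => ?_)
  · exact (Complex.continuous_conj.measurable.comp
      ((continuous_sphHarmonic ℓ m).measurable.comp hdir)).aestronglyMeasurable
  · rw [RCLike.norm_conj]
    refine hC _ ?_
    rcases eq_or_ne x 0 with rfl | hx
    · simp [dir]
    · simpa using (norm_dir hx).le

lemma modMultipole_pseudoCharge {lam : ℝ} (hlam : 0 < lam) (τ : E3) {R : ℝ} (hR : 0 < R)
    (ℓmax : ℕ) (n : ℕ → ℕ) (a : ℕ → ℂ) (Q : ℕ → ℤ → ℂ) {ℓ : ℕ} (hℓ : ℓ ≤ ℓmax) {m : ℤ}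
    (hm : m ∈ Set.Icc (-(ℓ : ℤ)) (ℓ : ℤ)) :
    modMultipole lam τ R (pseudoCharge τ R ℓmax n a Q) ℓ m =
      Q ℓ m * (a ℓ * (-2) ^ (n ℓ) * ((n ℓ)! : ℂ) * (R : ℂ) ^ (ℓ + n ℓ + 2) * ((2 * ℓ + 1)‼ : ℂ) *
        (sphBesselI (ℓ + n ℓ + 1) (lam * R) : ℂ) / (lam : ℂ) ^ (ℓ + n ℓ + 1)) := by
  have hIc := continuous_sphBesselI ℓ
  have hlam' : (lam : ℂ) ≠ 0 := by exact_mod_cast hlam.ne'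
  have hg : IntegrableOn (fun x : E3 => (sphBesselI ℓ (lam * ‖x‖) : ℂ) *
      conj (sphHarmonic ℓ m (dir x))) (Metric.closedBall (0 : E3) R) :=
    (integrableOn_sphHarmonic_dir ℓ m R).continuousOn_mul
      (Continuous.continuousOn (by fun_prop)) (isCompact_closedBall _ _)
  have hint : ∀ ℓ' ≤ ℓmax, ∀ m' ∈ Set.Icc (-(ℓ' : ℤ)) (ℓ' : ℤ),
      a ℓ' * Q ℓ' m' * ∫ x in Metric.closedBall (0 : E3) R,
        ((‖x‖ : ℂ) ^ 2 - (R : ℂ) ^ 2) ^ (n ℓ') * solidHarmonic ℓ' m' x *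
          ((sphBesselI ℓ (lam * ‖x‖) : ℂ) * conj (sphHarmonic ℓ m (dir x))) =
      if ℓ' = ℓ ∧ m' = m then a ℓ' * Q ℓ' m' * ∫ r in (0 : ℝ)..R, (r : ℂ) ^ 2 *
        (((r : ℂ) ^ 2 - (R : ℂ) ^ 2) ^ (n ℓ') * (r : ℂ) ^ ℓ' *
          (sphBesselI ℓ (lam * r) : ℂ)) else 0 := by
    intro ℓ' _ m' hm'
    have h := setIntegral_radial_mul_sphHarmonic hR.le
      (fun r => ((r : ℂ) ^ 2 - (R : ℂ) ^ 2) ^ (n ℓ') * (r : ℂ) ^ ℓ' *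
          (sphBesselI ℓ (lam * r) : ℂ)) hm' hm
    rw [← mul_ite_zero, ← h]
    congr 2 with x
    rw [← norm_pow_mul_sphHarmonic hm']
    ring
  have hrad : ∫ r in (0 : ℝ)..R, (r : ℂ) ^ 2 *
        (((r : ℂ) ^ 2 - (R : ℂ) ^ 2) ^ (n ℓ) * (r : ℂ) ^ ℓ * (sphBesselI ℓ (lam * r) : ℂ)) =
      (-2) ^ n ℓ * ((n ℓ)! : ℂ) * (R : ℂ) ^ (ℓ + n ℓ + 2) / (lam : ℂ) ^ (n ℓ + 1) *
        (sphBesselI (ℓ + n ℓ + 1) (lam * R) : ℂ) := by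
    have h := congrArg (fun y : ℝ => (y : ℂ)) (integral_mul_sphBesselI R lam hR.le hlam ℓ (n ℓ))
    simp only [← intervalIntegral.integral_ofReal] at h
    push_cast at h
    rw [← h]
    congr 1
    funext r
    ring
  rw [modMultipole]
  simp_rw [mul_assoc (pseudoCharge τ R ℓmax n a Q _)]
  rw [setIntegral_pseudoCharge_mul τ R ℓmax n a Q hg, sumL_congr hint,
    sumL_ite_eq hℓ hm (fun ℓ' m' => a ℓ' * Q ℓ' m' * ∫ r in (0 : ℝ)..R, (r : ℂ) ^ 2 *
        (((r : ℂ) ^ 2 - (R : ℂ) ^ 2) ^ (n ℓ') * (r : ℂ) ^ ℓ' * (sphBesselI ℓ (lam * r) : ℂ))),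
    hrad]
  field_simp
  ring

/-! ### Truncated polynomials -/

/-- The function that agrees with the polynomial `p` up to `R` and vanishes beyond `R`. -/
def truncPoly (R : ℝ) (p : ℂ[X]) (r : ℝ) : ℂ := if r ≤ R then p.eval (r : ℂ) else 0

lemma hasDerivAt_eval_ofReal (p : ℂ[X]) (r : ℝ) :
    HasDerivAt (fun r : ℝ => p.eval (r : ℂ)) (p.derivative.eval (r : ℂ)) r :=
  (p.hasDerivAt (r : ℂ)).comp_ofReal

lemma eval_eq_zero_of_pow_dvd {c : ℂ} {k : ℕ} {p : ℂ[X]} (hp : (X - C c) ^ (k + 1) ∣ p) :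
    p.eval c = 0 := by
  have : (X - C c) ∣ p := (dvd_pow_self _ k.succ_ne_zero).trans hp
  exact dvd_iff_isRoot.1 this

lemma pow_dvd_derivative {c : ℂ} {k : ℕ} {p : ℂ[X]} (hp : (X - C c) ^ (k + 1) ∣ p) :
    (X - C c) ^ k ∣ derivative p := by
  have h := pow_sub_one_dvd_derivative_of_pow_dvd hp
  rwa [Nat.add_sub_cancel] at h

/-- At a root of multiplicity at least two, value and slope of both branches agree at `R`. -/
lemma hasDerivAt_truncPoly {R : ℝ} {k : ℕ} {p : ℂ[X]} (hp : (X - C (R : ℂ)) ^ (k + 1 + 1) ∣ p)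
    (r : ℝ) : HasDerivAt (truncPoly R p) (truncPoly R p.derivative r) r := by
  have hp' : (X - C (R : ℂ)) ^ (k + 1) ∣ p.derivative :=
    pow_dvd_derivative hp
  rcases lt_trichotomy r R with h | rfl | h
  · rw [truncPoly, if_pos h.le]
    refine (hasDerivAt_eval_ofReal p r).congr_of_eventuallyEq ?_
    filter_upwards [Iio_mem_nhds h] with s hs
    exact if_pos (le_of_lt hs)
  · rw [truncPoly, if_pos le_rfl, eval_eq_zero_of_pow_dvd hp', ← hasDerivWithinAt_univ,
      ← Set.Iic_union_Ici (a := r)]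
    refine HasDerivWithinAt.union ?_ ?_
    · rw [← eval_eq_zero_of_pow_dvd hp']
      refine (hasDerivAt_eval_ofReal p r).hasDerivWithinAt.congr (fun s hs => if_pos hs)
        (if_pos le_rfl)
    · refine (hasDerivWithinAt_const r (Set.Ici r) (0 : ℂ)).congr (fun s hs => ?_) ?_
      · rcases eq_or_lt_of_le (Set.mem_Ici.1 hs) with rfl | hlt
        · rw [truncPoly, if_pos le_rfl, eval_eq_zero_of_pow_dvd hp]
        · exact if_neg hlt.not_ge
      · rw [truncPoly, if_pos le_rfl, eval_eq_zero_of_pow_dvd hp]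
  · rw [truncPoly, if_neg h.not_ge]
    refine (hasDerivAt_const r (0 : ℂ)).congr_of_eventuallyEq ?_
    filter_upwards [Ioi_mem_nhds h] with s hs
    exact if_neg (not_le.2 hs)

/-- Differentiation commutes with the cutoff and lowers the multiplicity of the root by at most one,
down to a continuous function vanishing at `R`. -/
lemma contDiff_truncPoly {R : ℝ} {k : ℕ} {p : ℂ[X]} (hp : (X - C (R : ℂ)) ^ (k + 1) ∣ p) :
    ContDiff ℝ k (truncPoly R p) ∧ iteratedDeriv k (truncPoly R p) R = 0 := by
  induction k generalizing p with
  | zero =>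
    refine ⟨contDiff_zero.2 ?_, ?_⟩
    · refine Continuous.if_le ?_ continuous_const continuous_id continuous_const ?_
      · exact p.continuous.comp Complex.continuous_ofReal
      · rintro r rfl
        exact eval_eq_zero_of_pow_dvd hp
    · rw [iteratedDeriv_zero, truncPoly, if_pos le_rfl, eval_eq_zero_of_pow_dvd hp]
  | succ k ih =>
    have hd : deriv (truncPoly R p) = truncPoly R p.derivative :=
      funext fun r => (hasDerivAt_truncPoly hp r).deriv
    have hp' : (X - C (R : ℂ)) ^ (k + 1) ∣ p.derivative :=
      pow_dvd_derivative hp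
    refine ⟨?_, ?_⟩
    · push_cast
      rw [contDiff_succ_iff_deriv, hd]
      exact ⟨fun r => (hasDerivAt_truncPoly hp r).differentiableAt, by simp, (ih hp').1⟩
    · rw [iteratedDeriv_succ', hd]
      exact (ih hp').2

lemma iteratedDeriv_eval_eq_zero {R : ℝ} {k : ℕ} {p : ℂ[X]} (hp : (X - C (R : ℂ)) ^ (k + 1) ∣ p) :
    iteratedDeriv k (fun r : ℝ => p.eval (r : ℂ)) R = 0 := by
  induction k generalizing p with
  | zero => rw [iteratedDeriv_zero, eval_eq_zero_of_pow_dvd hp]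
  | succ k ih =>
    have hd : deriv (fun r : ℝ => p.eval (r : ℂ)) = fun r : ℝ => p.derivative.eval (r : ℂ) :=
      funext fun r => (hasDerivAt_eval_ofReal p r).deriv
    rw [iteratedDeriv_succ', hd]
    exact ih (pow_dvd_derivative hp)

/-- The radial part of the pseudo-charge density as a polynomial. -/
def radialPoly (R : ℝ) (ℓ n : ℕ) (a Q : ℂ) : ℂ[X] :=
  C (a * Q) * X ^ ℓ * (X ^ 2 - C ((R : ℂ) ^ 2)) ^ n

lemma eval_radialPoly (R : ℝ) (ℓ n : ℕ) (a Q : ℂ) (r : ℝ) :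
    (radialPoly R ℓ n a Q).eval (r : ℂ) = pseudoRadial R ℓ n a Q r := by
  rw [pseudoRadial_eq, radialPoly]
  simp only [eval_mul, eval_pow, eval_sub, eval_X, eval_C]
  ring

lemma pow_dvd_radialPoly (R : ℝ) (ℓ : ℕ) {n k : ℕ} (hk : k < n) (a Q : ℂ) :
    (X - C (R : ℂ)) ^ (k + 1) ∣ radialPoly R ℓ n a Q := by
  have h : (X ^ 2 - C ((R : ℂ) ^ 2)) = (X - C (R : ℂ)) * (X + C (R : ℂ)) := by
    rw [C_pow]
    ring
  rw [radialPoly, h, mul_pow]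
  exact ((pow_dvd_pow _ hk).mul_right _).mul_left _

/-- Equality is only near `R`: for `r > 0` the direction of `r • u` is `u`, whereas for `r < 0` it
would be `-u`. -/
lemma pseudoCharge_ray_eventuallyEq (τ : E3) {R : ℝ} (hR : 0 < R) (ℓmax : ℕ) (n : ℕ → ℕ)
    (a : ℕ → ℂ) (Q : ℕ → ℤ → ℂ) {u : E3} (hu : ‖u‖ = 1) :
    (fun r : ℝ => pseudoCharge τ R ℓmax n a Q (r • u + τ)) =ᶠ[nhds R]
      truncPoly R (∑ ℓ ∈ Finset.range (ℓmax + 1), ∑ m ∈ Finset.Icc (-(ℓ : ℤ)) (ℓ : ℤ),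
        radialPoly R ℓ (n ℓ) (a ℓ) (Q ℓ m) * C (sphHarmonic ℓ m u)) := by
  filter_upwards [Ioi_mem_nhds hR] with r hr
  have hr' : (0 : ℝ) < r := hr
  have hn : ‖r • u‖ = r := by rw [norm_smul, hu, mul_one, Real.norm_of_nonneg hr'.le]
  have hdir : dir (r • u) = u := by
    rw [dir, hn, smul_smul, inv_mul_cancel₀ hr'.ne', one_smul]
  rw [pseudoCharge, add_sub_cancel_right, hn, hdir, truncPoly]
  simp only [eval_finsetSum, eval_mul, eval_C, eval_radialPoly]
  rfl

end Yukawa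

end

/-! ### The main theorem -/

open Yukawa in
theorem mainTheorem3
    (b : Module.Basis (Fin 3) ℝ E3) (lam : ℝ) (hlam : 0 < lam)
    (τ : E3) (R : ℝ) (hR : 0 < R)
    (ℓmax : ℕ) (n ν : ℕ → ℕ) (hν : ∀ ℓ, ν ℓ = ℓ + n ℓ + 1)
    (a : ℕ → ℂ) (ha : ∀ ℓ ≤ ℓmax, a ℓ ≠ 0)
    (q : ℕ → ℤ → ℂ) :
    -- exactly one choice of the coefficients reproduces the prescribed moments
    (∀ Q : ℕ → ℤ → ℂ,
      (∀ ℓ ≤ ℓmax, ∀ m ∈ Set.Icc (-(ℓ : ℤ)) (ℓ : ℤ),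
          modMultipole lam τ R (pseudoCharge τ R ℓmax n a Q) ℓ m = q ℓ m) ↔
        (∀ ℓ ≤ ℓmax, ∀ m ∈ Set.Icc (-(ℓ : ℤ)) (ℓ : ℤ),
          Q ℓ m = q ℓ m * ((lam : ℂ) ^ (ν ℓ) /
            (a ℓ * (-2) ^ (n ℓ) * ((n ℓ)! : ℂ) * (R : ℂ) ^ (ℓ + n ℓ + 2) * ((2 * ℓ + 1)‼ : ℂ) *
              (sphBesselI (ν ℓ) (lam * R) : ℂ))))) ∧
    ∀ Q : ℕ → ℤ → ℂ,
      (∀ ℓ ≤ ℓmax, ∀ m ∈ Set.Icc (-(ℓ : ℤ)) (ℓ : ℤ),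
          modMultipole lam τ R (pseudoCharge τ R ℓmax n a Q) ℓ m = q ℓ m) →
      -- closed form of the density in the ball
      (∀ x : E3, ‖x‖ ≤ R →
        pseudoCharge τ R ℓmax n a Q (x + τ) =
          sumL ℓmax fun ℓ m =>
            a ℓ * ((‖x‖ : ℂ) ^ 2 - (R : ℂ) ^ 2) ^ (n ℓ) * Q ℓ m * (‖x‖ : ℂ) ^ ℓ *
              sphHarmonic ℓ m (dir x)) ∧
      -- Fourier coefficients as integrals over the ball
      (∀ K ∈ reciprocalLattice b,
        fourierCoefficient b (periodize b (pseudoCharge τ R ℓmax n a Q)) K =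
          1 / (cellVolume b : ℂ) * Complex.exp (-(Complex.I * (inner ℝ K τ : ℂ))) *
            ∫ x in Metric.closedBall (0 : E3) R,
              pseudoCharge τ R ℓmax n a Q (x + τ) *
                Complex.exp (-(Complex.I * (inner ℝ K x : ℂ)))) ∧
      -- Fourier coefficients for `K ≠ 0`
      (∀ K ∈ reciprocalLattice b, K ≠ 0 →
        fourierCoefficient b (periodize b (pseudoCharge τ R ℓmax n a Q)) K =
          4 * (π : ℂ) / (cellVolume b : ℂ) * Complex.exp (-(Complex.I * (inner ℝ K τ : ℂ))) *
            sumL ℓmax fun ℓ m =>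
              (-Complex.I) ^ ℓ *
                ((sphBesselJ (ν ℓ) (‖K‖ * R) : ℂ) /
                  ((‖K‖ : ℂ) ^ (ν ℓ - ℓ) * ((2 * ℓ + 1)‼ : ℂ))) *
                ((lam : ℂ) ^ (ν ℓ) / (sphBesselI (ν ℓ) (lam * R) : ℂ)) *
                q ℓ m * sphHarmonic ℓ m (dir K)) ∧
      -- Fourier coefficient for `K = 0`
      fourierCoefficient b (periodize b (pseudoCharge τ R ℓmax n a Q)) 0 =
        (√(4 * π) : ℂ) / (cellVolume b : ℂ) *
          (((lam * R) ^ (ν 0) / (((2 * ν 0 + 1)‼ : ℝ) * sphBesselI (ν 0) (lam * R)) : ℝ) : ℂ) *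
          q 0 0 ∧
      -- vanishing radial derivatives of each radial part
      (∀ ℓ ≤ ℓmax, ∀ m ∈ Set.Icc (-(ℓ : ℤ)) (ℓ : ℤ), ∀ k < n ℓ,
        iteratedDeriv k (pseudoRadial R ℓ (n ℓ) (a ℓ) (Q ℓ m)) R = 0) ∧
      -- smooth vanishing of the localized density along every ray
      (∀ k : ℕ, (∀ ℓ ≤ ℓmax, k < n ℓ) → ∀ u : E3, ‖u‖ = 1 →
        ContDiffAt ℝ k (fun r : ℝ => pseudoCharge τ R ℓmax n a Q (r • u + τ)) R ∧
        iteratedDeriv k (fun r : ℝ => pseudoCharge τ R ℓmax n a Q (r • u + τ)) R = 0) := by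
  have hlam' : (lam : ℂ) ≠ 0 := by exact_mod_cast hlam.ne'
  have hR' : (R : ℂ) ≠ 0 := by exact_mod_cast hR.ne'
  have hI : ∀ k, (sphBesselI k (lam * R) : ℂ) ≠ 0 := fun k => by
    exact_mod_cast (sphBesselI_pos k (mul_pos hlam hR)).ne'
  have hdf : ∀ k : ℕ, ((k‼ : ℕ) : ℂ) ≠ 0 := fun k => by
    exact_mod_cast (Nat.doubleFactorial_pos k).ne'
  have hfac : ∀ k : ℕ, ((k ! : ℕ) : ℂ) ≠ 0 := fun k => by
    exact_mod_cast (Nat.factorial_pos k).ne'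
  obtain rfl : ν = fun ℓ => ℓ + n ℓ + 1 := funext hν
  have hiff : ∀ Q : ℕ → ℤ → ℂ, ∀ ℓ ≤ ℓmax, ∀ m ∈ Set.Icc (-(ℓ : ℤ)) (ℓ : ℤ),
      (modMultipole lam τ R (pseudoCharge τ R ℓmax n a Q) ℓ m = q ℓ m ↔
        Q ℓ m = q ℓ m * ((lam : ℂ) ^ (ℓ + n ℓ + 1) /
          (a ℓ * (-2) ^ (n ℓ) * ((n ℓ)! : ℂ) * (R : ℂ) ^ (ℓ + n ℓ + 2) * ((2 * ℓ + 1)‼ : ℂ) *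
            (sphBesselI (ℓ + n ℓ + 1) (lam * R) : ℂ)))) := by
    intro Q ℓ hℓ m hm
    rw [modMultipole_pseudoCharge hlam τ hR ℓmax n a Q hℓ hm, ← eq_div_iff, div_eq_mul_inv,
      inv_div]
    exact div_ne_zero (mul_ne_zero (mul_ne_zero (mul_ne_zero (mul_ne_zero (mul_ne_zero (ha ℓ hℓ)
      (pow_ne_zero _ (by norm_num))) (hfac _)) (pow_ne_zero _ hR')) (hdf _)) (hI _))
      (pow_ne_zero _ hlam')
  refine ⟨fun Q => ⟨fun h ℓ hℓ m hm => (hiff Q ℓ hℓ m hm).1 (h ℓ hℓ m hm),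
    fun h ℓ hℓ m hm => (hiff Q ℓ hℓ m hm).2 (h ℓ hℓ m hm)⟩, fun Q hQ => ?_⟩
  replace hQ := fun ℓ hℓ m hm => (hiff Q ℓ hℓ m hm).1 (hQ ℓ hℓ m hm)
  have hball : ∀ K ∈ reciprocalLattice b,
      fourierCoefficient b (periodize b (pseudoCharge τ R ℓmax n a Q)) K =
        1 / (cellVolume b : ℂ) * Complex.exp (-(Complex.I * (inner ℝ K τ : ℂ))) *
          ∫ x in Metric.closedBall (0 : E3) R,
            pseudoCharge τ R ℓmax n a Q (x + τ) *
              Complex.exp (-(Complex.I * (inner ℝ K x : ℂ))) := by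
    intro K hK
    rw [fourierCoefficient_periodize b (integrable_pseudoCharge τ R ℓmax n a Q) hK,
      integral_pseudoCharge_mul_exp, mul_assoc]
  refine ⟨fun x hx => pseudoCharge_of_le τ ℓmax n a Q hx, hball, fun K hK hK0 => ?_, ?_, ?_, ?_⟩
  · have hκ : (‖K‖ : ℂ) ≠ 0 := by exact_mod_cast norm_ne_zero_iff.2 hK0
    rw [hball K hK, setIntegral_pseudoCharge_mul τ R ℓmax n a Q
      (Continuous.continuousOn (by fun_prop) |>.integrableOn_compact (isCompact_closedBall _ _)),
      mul_sumL, mul_sumL]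
    refine sumL_congr fun ℓ hℓ m hm => ?_
    rw [setIntegral_solidHarmonic_mul_exp hR.le (n ℓ) hm hK0, hQ ℓ hℓ m hm,
      show ℓ + n ℓ + 1 - ℓ = n ℓ + 1 by omega]
    have h1 := ha ℓ hℓ
    have h2 := hI (ℓ + n ℓ + 1)
    have h3 := hdf (2 * ℓ + 1)
    have h4 := hfac (n ℓ)
    have h5 : ((-2 : ℂ)) ^ n ℓ ≠ 0 := pow_ne_zero _ (by norm_num)
    -- The power of `-2` in the integral cancels the one in `Q ℓ m`; only its being nonzero matters.
    generalize ((-2 : ℂ)) ^ n ℓ = z at h5 ⊢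
    field_simp
  · have h0 : (0 : E3) ∈ reciprocalLattice b := fun v _ => ⟨0, by simp⟩
    have hm0 : (0 : ℤ) ∈ Set.Icc (-((0 : ℕ) : ℤ)) ((0 : ℕ) : ℤ) := by simp
    rw [hball 0 h0, setIntegral_pseudoCharge_mul τ R ℓmax n a Q
      (Continuous.continuousOn (by fun_prop) |>.integrableOn_compact (isCompact_closedBall _ _))]
    simp only [inner_zero_left, Complex.ofReal_zero, mul_zero, neg_zero, Complex.exp_zero, mul_one,
      setIntegral_solidHarmonic hR.le]
    have hsum : (sumL ℓmax fun ℓ m => a ℓ * Q ℓ m * if ℓ = 0 then 4 * (π : ℂ) *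
        solidHarmonic 0 m 0 * ((-2) ^ n ℓ * ((n ℓ)! : ℂ) * (R : ℂ) ^ (2 * n ℓ + 3) /
          ((2 * n ℓ + 3)‼ : ℂ)) else 0) =
        sumL ℓmax fun ℓ m => if ℓ = 0 ∧ m = 0 then a ℓ * Q ℓ m * (4 * (π : ℂ) *
          solidHarmonic 0 m 0 * ((-2) ^ n ℓ * ((n ℓ)! : ℂ) * (R : ℂ) ^ (2 * n ℓ + 3) /
            ((2 * n ℓ + 3)‼ : ℂ))) else 0 := by
      refine sumL_congr fun ℓ _ m hm => ?_
      rw [mul_ite_zero]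
      refine if_congr ⟨fun h => ⟨h, ?_⟩, fun h => h.1⟩ rfl rfl
      subst h
      obtain ⟨h1, h2⟩ := hm
      simp only [Nat.cast_zero, neg_zero] at h1 h2
      exact le_antisymm h2 h1
    rw [hsum, sumL_ite_eq (Nat.zero_le _) hm0 (fun ℓ m => a ℓ * Q ℓ m * (4 * (π : ℂ) *
          solidHarmonic 0 m 0 * ((-2) ^ n ℓ * ((n ℓ)! : ℂ) * (R : ℂ) ^ (2 * n ℓ + 3) /
            ((2 * n ℓ + 3)‼ : ℂ)))), hQ 0 (Nat.zero_le _) 0 hm0]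
    -- The constant harmonic is `1 / √(4π)`, which accounts for the prefactor `√(4π)`.
    have hY : 4 * (π : ℂ) * solidHarmonic 0 0 0 = (√(4 * π) : ℂ) := by
      have h1 : solidHarmonic 0 0 0 = ((√(4 * π))⁻¹ : ℂ) := by
        simp [solidHarmonic, harm, harmNorm]
      have h2 : (√(4 * π) : ℂ) * (√(4 * π) : ℂ) = 4 * (π : ℂ) := by
        rw [← Complex.ofReal_mul, Real.mul_self_sqrt (by positivity)]
        push_cast
        rfl
      have h3 : (√(4 * π) : ℂ) ≠ 0 := by
        exact_mod_cast (Real.sqrt_pos.2 (by positivity)).ne'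
      rw [h1, ← h2, mul_assoc, mul_inv_cancel₀ h3, mul_one]
    rw [hY, show 2 * (0 + n 0 + 1) + 1 = 2 * n 0 + 3 by ring]
    have h1 := ha 0 (Nat.zero_le _)
    have h2 := hI (0 + n 0 + 1)
    have h3 := hdf (2 * n 0 + 3)
    have h4 := hfac (n 0)
    have h5 : ((-2 : ℂ)) ^ n 0 ≠ 0 := pow_ne_zero _ (by norm_num)
    generalize ((-2 : ℂ)) ^ n 0 = z at h5 ⊢
    push_cast
    simp only [zero_add, Nat.doubleFactorial, Nat.cast_one] at h2 ⊢
    field_simp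
    ring
  · intro ℓ _ m _ k hk
    have h := iteratedDeriv_eval_eq_zero (pow_dvd_radialPoly R ℓ hk (a ℓ) (Q ℓ m))
    simpa only [eval_radialPoly] using h
  · intro k hk u hu
    have heq := pseudoCharge_ray_eventuallyEq τ hR ℓmax n a Q hu
    have h := contDiff_truncPoly (k := k) (R := R)
      (p := ∑ ℓ ∈ Finset.range (ℓmax + 1), ∑ m ∈ Finset.Icc (-(ℓ : ℤ)) (ℓ : ℤ),
        radialPoly R ℓ (n ℓ) (a ℓ) (Q ℓ m) * C (sphHarmonic ℓ m u))
      (Finset.dvd_sum fun ℓ hℓ => Finset.dvd_sum fun m _ =>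
        (pow_dvd_radialPoly R ℓ (hk ℓ (Nat.lt_succ_iff.1 (Finset.mem_range.1 hℓ))) _ _).mul_right _)
    exact ⟨h.1.contDiffAt.congr_of_eventuallyEq heq, (heq.iteratedDeriv_eq k).trans h.2⟩
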